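/- Let $B\subset\mathbb R^2$ be an open disk and let $\Omega,\widehat B$ be bounded Lipschitz domains (open, connected, nonempty) and $D$ an open set (for instance a convex polygon or a Lipschitz domain) with $\overline D\subset\Omega$, $\overline{\widehat B}\subset\Omega$ and $\overline\Omega\subset B$. Let $\eta\in C(\partial\Omega)$, $\hat\eta\in C(\partial\widehat B)$ be complex valued, $\sigma\in\mathbb C\setminus\{0\}$, $q,\tau,\kappa\in\mathbb C$, and $f\in H^{-1/2}(\partial B)$. The normal $\nu$ on $\partial B$, $\partial\Omega$, $\partial\widehat B$ points to the exterior of $B$, $\Omega$, $\widehat B$. Solutions in $B\setminus K$ ($K=\overline D,\overline\Omega,\overline{\widehat B}$) are functions in $L^2(B\setminus K)$ that belong to $H^1(B_1\setminus K)$ for every smaller concentric disk $B_1$; equations and boundary conditions hold in the weak (trace) sense, the Dirichlet and Neumann traces on $\partial B$ being taken in $H^{-1/2}(\partial B)$ and $H^{-3/2}(\partial B)$. For $k^2\in\mathbb C$ consider the impedance problem $$\Delta v+k^2v=0\ \text{in }B\setminus\overline{\widehat B},\qquad v=f\ \text{on }\partial B,\qquad \partial_\nu v+\hat\eta v=0\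 \text{on }\partial\widehat B. \tag{1}$$ Assume that (1) is uniquely solvable (for every boundary value in $H^{-1/2}(\partial B)$) for $k^2=\kappa^2$ and for $k^2=q/\sigma$, and let $A(k^2,\widehat B)f=\partial_\nu v|_{\partial B}$ be its Dirichlet-to-Neumann operator. Assume that the problem $$\Delta v+\tfrac q\sigma v=0\ \text{in }B\setminus\overline\Omega,\qquad v=0\ \text{on }\partial B,\qquad \partial_\nu v+\eta v=g\ \text{on }\partial\Omega \tag{2}$$ has only the trivial solution for $g=0$, and let $G(q/\sigma,\Omega)g=\partial_\nu v|_{\partial B}$, $g\in H^{-1/2}(\partial\Omega)$, where $v$ solves (2). Let $u$ solve $\nabla\cdot(\sigma\nabla u)+qu=0$ in $B\setminus\overline D$, $u=f$ on $\partial B$, $u=0$ on $\partial D$, let $\tilde u_0(\cdot,\kappa^2)$ solve (1) with $k^2=\kappa^2$, and put $\tilde p(\tau,\kappa^2)=\sigma\partial_\nu u-\tau\partial_\nu\tilde u_0(\cdot,\kappa^2)$ on $\partial B$. Then: (i) If $\tau=\sigma$ and $\kappa^2=q/\sigma$, then $\tilde p(\tau,\kappa^2)\in\operatorname{Ran}G(q/\sigma,\Omega)$.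 (ii) $\tilde p(\tau,\kappa^2)\in\operatorname{Ran}G(q/\sigma,\Omega)$ if and only if $[\sigma A(q/\sigma,\widehat B)-\tau A(\kappa^2,\widehat B)]f\in\operatorname{Ran}G(q/\sigma,\Omega)$. -/

import Mathlib

open MeasureTheory Set Metric
open scoped ContDiff ENNReal Laplacian

noncomputable section

namespace OneWave

/-! The plane is identified with `ℂ`; the disk `B` is `ball c R`. -/

/-- Smooth compactly supported complex valued functions on the plane. -/
def TestFun : Submodule ℂ (ℂ → ℂ) where
  carrier := {φ | ContDiff ℝ ∞ φ ∧ HasCompactSupport φ}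
  add_mem' h₁ h₂ := ⟨h₁.1.add h₂.1, h₁.2.add h₂.2⟩
  zero_mem' := ⟨contDiff_const, HasCompactSupport.zero⟩
  smul_mem' a _ h := ⟨h.1.const_smul a, h.2.smul_left (f := fun _ => a)⟩

/-- First partial derivative, in the direction of the first coordinate. -/
def d₁ (φ : ℂ → ℂ) (x : ℂ) : ℂ := fderiv ℝ φ x 1

/-- First partial derivative, in the direction of the second coordinate. -/
def d₂ (φ : ℂ → ℂ) (x : ℂ) : ℂ := fderiv ℝ φ x Complex.I

/-- A bounded Lipschitz domain: a nonempty connected bounded open set which, near each of its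
boundary points and after a rotation by the unit vector `e`, is the set of points above the graph
of a Lipschitz function. -/
structure IsLipschitzDomain (Ω : Set ℂ) : Prop where
  isOpen : IsOpen Ω
  isConnected : IsConnected Ω
  isBounded : Bornology.IsBounded Ω
  graph : ∀ p ∈ frontier Ω, ∃ e : ℂ, ‖e‖ = 1 ∧ ∃ r > 0, ∃ K, ∃ γ : ℝ → ℝ, LipschitzWith K γ ∧
    ∀ x ∈ ball p r, (x ∈ Ω ↔ γ (((x - p) / e).re) < ((x - p) / e).im)

/-- Arc length measure on the boundary of `Ω`. -/
def bdry (Ω : Set ℂ) : Measure ℂ := (Measure.hausdorffMeasure 1).restrict (frontier Ω)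

/-! ### Sobolev spaces on the circle `∂B` -/

/-- A distribution `∑ aₙ e^{inθ}` on a circle is given by the sequence of its Fourier
coefficients; it belongs to `H^s` if `∑ (n² + 1)^s |aₙ|² < ∞`. -/
def MemHs (s : ℝ) (a : ℤ → ℂ) : Prop :=
  Summable fun n : ℤ => ((n : ℝ) ^ 2 + 1) ^ s * ‖a n‖ ^ 2

/-- The duality pairing `∫_{∂B} a h ds`, `a = ∑ aₙ e^{inθ}`, with a smooth function `h(θ)` on the
circle of radius `R`. -/
def circlePairing (R : ℝ) (a : ℤ → ℂ) (h : ℝ → ℂ) : ℂ :=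
  R * ∑' n : ℤ, a n * ∫ θ in (0 : ℝ)..2 * Real.pi, h θ * Complex.exp (n * θ * Complex.I)

/-- Boundary values of `φ` on the circle with centre `c` and radius `R`. -/
def onCircle (c : ℂ) (R : ℝ) (φ : ℂ → ℂ) (θ : ℝ) : ℂ := φ (circleMap c R θ)

/-- Exterior normal derivative of `φ` on the circle with centre `c` and radius `R`. -/
def normalOnCircle (c : ℂ) (R : ℝ) (φ : ℂ → ℂ) (θ : ℝ) : ℂ :=
  fderiv ℝ φ (circleMap c R θ) (Complex.exp (θ * Complex.I))

/-! ### The Sobolev space `H^{-1/2}(∂Ω)` -/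

/-- The norm of `H¹(ℝ²)` for test functions. -/
def h1Norm (φ : ℂ → ℂ) : ℝ := Real.sqrt (∫ x, (‖φ x‖ ^ 2 + ‖d₁ φ x‖ ^ 2 + ‖d₂ φ x‖ ^ 2))

/-- `H^{-1/2}(∂Ω)`, the dual of the trace space `H^{1/2}(∂Ω)` with its quotient norm: a
functional is given by its values on the (dense) restrictions of test functions to `∂Ω`; it
depends on `φ|_{∂Ω}` only, and it is bounded by the `H¹` norm. -/
def HNegHalf (Ω : Set ℂ) : Submodule ℂ (TestFun →ₗ[ℂ] ℂ) where
  carrier := {g | (∀ φ : TestFun, (∀ x ∈ frontier Ω, (φ : ℂ → ℂ) x = 0) → g φ = 0) ∧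
    ∃ C : ℝ, ∀ φ : TestFun, ‖g φ‖ ≤ C * h1Norm φ}
  add_mem' := by
    rintro g₁ g₂ ⟨h₁, C₁, k₁⟩ ⟨h₂, C₂, k₂⟩
    refine ⟨fun φ hφ => by simp [h₁ φ hφ, h₂ φ hφ], C₁ + C₂, fun φ => ?_⟩
    calc ‖(g₁ + g₂) φ‖ ≤ ‖g₁ φ‖ + ‖g₂ φ‖ := norm_add_le _ _
      _ ≤ C₁ * h1Norm φ + C₂ * h1Norm φ := add_le_add (k₁ φ) (k₂ φ)
      _ = (C₁ + C₂) * h1Norm φ := by ring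
  zero_mem' := ⟨fun _ _ => rfl, 0, fun _ => by simp⟩
  smul_mem' := by
    rintro a g ⟨h, C, k⟩
    refine ⟨fun φ hφ => by simp [h φ hφ], ‖a‖ * C, fun φ => ?_⟩
    calc ‖(a • g) φ‖ = ‖a‖ * ‖g φ‖ := norm_smul a (g φ)
      _ ≤ ‖a‖ * (C * h1Norm φ) := mul_le_mul_of_nonneg_left (k φ) (norm_nonneg a)
      _ = ‖a‖ * C * h1Norm φ := by ring

/-! ### Functions and boundary values in `B ∖ K` -/

/-- `(p, q)` is the weak gradient of `v` in the open set `U`. -/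
def HasWeakGradient (U : Set ℂ) (v p q : ℂ → ℂ) : Prop :=
  ∀ φ ∈ TestFun, tsupport φ ⊆ U →
    (∫ x in U, v x * d₁ φ x) = -(∫ x in U, p x * φ x) ∧
    (∫ x in U, v x * d₂ φ x) = -(∫ x in U, q x * φ x)

/-- The solution space in `B ∖ K`, `K` compact in `B`: the function `v` is in `L²(B ∖ K)`, and it
is in `H¹(B₁ ∖ K)` for every smaller concentric disk `B₁`, with weak gradient `(p, q)`. -/
structure InSolutionSpace (c : ℂ) (R : ℝ) (K : Set ℂ) (v p q : ℂ → ℂ) : Prop where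
  memLp : MemLp v 2 (volume.restrict (ball c R \ K))
  weakGradient : HasWeakGradient (ball c R \ K) v p q
  memLp₁ : ∀ r < R, MemLp p 2 (volume.restrict (ball c r \ K))
  memLp₂ : ∀ r < R, MemLp q 2 (volume.restrict (ball c r \ K))

/-- The test function `φ` is `ε`-close to `v`, with weak gradient `(p, q)`, in `H¹(U)`. -/
def H1Close (U : Set ℂ) (v p q φ : ℂ → ℂ) (ε : ℝ≥0∞) : Prop :=
  eLpNorm (v - φ) 2 (volume.restrict U) < ε ∧
  eLpNorm (p - d₁ φ) 2 (volume.restrict U) < ε ∧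
  eLpNorm (q - d₂ φ) 2 (volume.restrict U) < ε

/-- `t ∈ L²(∂Ω)` is the trace on `∂Ω`, from `B ∖ Ω̄`, of `v` with weak gradient `(p, q)`. -/
def IsTrace (c : ℂ) (R : ℝ) (Ω : Set ℂ) (v p q t : ℂ → ℂ) : Prop :=
  MemLp t 2 (bdry Ω) ∧
  ∀ r < R, ∀ ε > 0, ∃ φ ∈ TestFun, H1Close (ball c r \ closure Ω) v p q φ ε ∧
    eLpNorm (t - φ) 2 (bdry Ω) < ε

/-- `v = 0` on `∂D`, in the sense of `H¹₀`: near `D̄`, the function `v` is an `H¹` limit of test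
functions that vanish in a neighbourhood of `D̄`. -/
def VanishesOnBoundary (c : ℂ) (R : ℝ) (D : Set ℂ) (v p q : ℂ → ℂ) : Prop :=
  ∀ r < R, ∀ ε > 0, ∃ φ ∈ TestFun, Disjoint (tsupport φ) (closure D) ∧
    H1Close (ball c r \ closure D) v p q φ ε

/-- The solution `v ∈ L²(B ∖ K)` of `Δv + k²v = 0` has the Cauchy data `v = f ∈ H^{-1/2}(∂B)` and
`∂_ν v = ψ ∈ H^{-3/2}(∂B)`: these are the traces defined by duality through Green's second
identity, with test functions that vanish near `K`. -/
structure HasCauchyData (c : ℂ) (R : ℝ) (K : Set ℂ) (k2 : ℂ) (v : ℂ → ℂ) (f ψ : ℤ → ℂ) :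
    Prop where
  dirichlet_mem : MemHs (-1 / 2) f
  neumann_mem : MemHs (-3 / 2) ψ
  green : ∀ φ ∈ TestFun, Disjoint (tsupport φ) K →
    ∫ x in ball c R \ K, v x * ((Δ φ) x + k2 * φ x) =
      circlePairing R f (normalOnCircle c R φ) - circlePairing R ψ (onCircle c R φ)

/-! ### The boundary value problems -/

/-- `u` solves `∇·(σ∇u) + qu = 0` in `B ∖ D̄`, `u = f` on `∂B`, `u = 0` on `∂D`, and
`∂_ν u = ψ` on `∂B`. -/
def SolvesDirichlet (c : ℂ) (R : ℝ) (D : Set ℂ) (σ q : ℂ) (f ψ : ℤ → ℂ) (u : ℂ → ℂ) : Prop :=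
  ∃ p₁ p₂ : ℂ → ℂ, InSolutionSpace c R (closure D) u p₁ p₂ ∧
    (∀ φ ∈ TestFun, tsupport φ ⊆ ball c R \ closure D →
      ∫ x in ball c R \ closure D,
        (σ * (p₁ x * d₁ φ x + p₂ x * d₂ φ x) - q * u x * φ x) = 0) ∧
    VanishesOnBoundary c R D u p₁ p₂ ∧
    HasCauchyData c R (closure D) (q / σ) u f ψ

/-- `v` solves `Δv + k²v = 0` in `B ∖ Ω̄`, `v = f` on `∂B`, `∂_ν v + ηv = g` on `∂Ω`, with `ν`
exterior to `Ω`, and `∂_ν v = ψ` on `∂B`. The equation and the impedance condition are in weak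
form: `∫_{B∖Ω̄} (∇v·∇φ - k²vφ) dx = ∫_{∂Ω} ηvφ ds - ⟨g, φ⟩` for all `φ ∈ C_c^∞(B)`. -/
def SolvesImpedance (c : ℂ) (R : ℝ) (Ω : Set ℂ) (η : ℂ → ℂ) (k2 : ℂ) (f : ℤ → ℂ)
    (g : HNegHalf Ω) (ψ : ℤ → ℂ) (v : ℂ → ℂ) : Prop :=
  ∃ p₁ p₂ t : ℂ → ℂ, InSolutionSpace c R (closure Ω) v p₁ p₂ ∧
    IsTrace c R Ω v p₁ p₂ t ∧
    (∀ φ : TestFun, tsupport (φ : ℂ → ℂ) ⊆ ball c R →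
      ∫ x in ball c R \ closure Ω,
        (p₁ x * d₁ φ x + p₂ x * d₂ φ x - k2 * v x * (φ : ℂ → ℂ) x) =
      (∫ x, η x * t x * (φ : ℂ → ℂ) x ∂(bdry Ω)) - g.1 φ) ∧
    HasCauchyData c R (closure Ω) k2 v f ψ

/-- `k²` is not an eigenvalue of the impedance problem in `B ∖ Ω̄`: the homogeneous problem has
only the trivial solution. -/
def NotEigenvalue (c : ℂ) (R : ℝ) (Ω : Set ℂ) (η : ℂ → ℂ) (k2 : ℂ) : Prop :=
  ∀ (v : ℂ → ℂ) (ψ : ℤ → ℂ), SolvesImpedance c R Ω η k2 0 0 ψ v →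
    v =ᵐ[volume.restrict (ball c R \ closure Ω)] 0

/-- The impedance problem `Δv + k²v = 0` in `B ∖ Ω̄`, `v = f` on `∂B`, `∂_ν v + ηv = 0` on `∂Ω`
has exactly one solution for every `f ∈ H^{-1/2}(∂B)`. -/
def UniquelySolvable (c : ℂ) (R : ℝ) (Ω : Set ℂ) (η : ℂ → ℂ) (k2 : ℂ) : Prop :=
  ∀ f : ℤ → ℂ, MemHs (-1 / 2) f →
    (∃ (v : ℂ → ℂ) (ψ : ℤ → ℂ), SolvesImpedance c R Ω η k2 f 0 ψ v) ∧
    ∀ (v v' : ℂ → ℂ) (ψ ψ' : ℤ → ℂ),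
      SolvesImpedance c R Ω η k2 f 0 ψ v → SolvesImpedance c R Ω η k2 f 0 ψ' v' →
      v =ᵐ[volume.restrict (ball c R \ closure Ω)] v'

open Classical in
/-- The Dirichlet-to-Neumann operator `A(k², Ω) : f ↦ ∂_ν v|_{∂B}` of the impedance problem. -/
def dtn (c : ℂ) (R : ℝ) (Ω : Set ℂ) (η : ℂ → ℂ) (k2 : ℂ) (f : ℤ → ℂ) : ℤ → ℂ :=
  if h : ∃ ψ : ℤ → ℂ, ∃ v : ℂ → ℂ, SolvesImpedance c R Ω η k2 f 0 ψ v then h.choose else 0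

open Classical in
/-- The operator `G(k², Ω) : g ↦ ∂_ν v|_{∂B}` on `H^{-1/2}(∂Ω)`, where `v` solves
`Δv + k²v = 0` in `B ∖ Ω̄`, `v = 0` on `∂B`, `∂_ν v + ηv = g` on `∂Ω`. -/
def opG (c : ℂ) (R : ℝ) (Ω : Set ℂ) (η : ℂ → ℂ) (k2 : ℂ) (g : HNegHalf Ω) : ℤ → ℂ :=
  if h : ∃ ψ : ℤ → ℂ, ∃ v : ℂ → ℂ, SolvesImpedance c R Ω η k2 0 g ψ v then h.choose else 0

end OneWave

end

/-!
Let `u` be the solution in `B ∖ closure D` and `v` the solution of the impedance problem (with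
`k² = q/σ`) in `B ∖ closure Bhat`, both with the Dirichlet data `f`. Both satisfy the Helmholtz
equation `Δw + (q/σ)w = 0` in a neighbourhood of `B ∖ Ω`, so `u - v`, restricted to
`B ∖ closure Ω`, vanishes on `∂B` and solves the problem behind `G(q/σ, Ω)` with some impedance
data on `∂Ω`. Thus `σ(∂_ν u - A(q/σ, Bhat) f)` is in the range of `G(q/σ, Ω)`
(`smul_sub_mem_range_opG`), which is a linear subspace (`mem_range_opG_congr`). Since
`∂_ν u₀ = A(κ², Bhat) f`, both claims follow.

The analytic content is that a solution in `B ∖ K`, with `K ⊆ Ω`, has impedance data in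
`H^{-1/2}(∂Ω)` (`exists_solvesImpedance`). The data are given by
`g(φ) = ∫_{∂Ω} ηwφ ds - ∫_{B ∖ closure Ω} (∇w·∇(χφ) - k²wχφ) dx`, where `χ` is a cutoff function,
and three facts are used.

* The trace inequality `‖φ‖_{L²(∂Ω)} ≤ C ‖φ‖_{H¹(ℝ²)}` (`IsLipschitzDomain.exists_trace_le`),
  proved by integrating a one-dimensional inequality along the lines that cross a Lipschitz graph.
* The density of test functions in `H¹(ℝ²)` (`exists_testFun_sobNorm_sub_le`), proved by
  mollification. With the trace inequality it gives the trace of `w` on `∂Ω`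
  (`InSolutionSpace.exists_isTrace`).
* The weak equation may be tested with functions that merely vanish on `∂Ω`
  (`integral_weakForm_eq_zero`). Hence `g(φ)` depends on the boundary values of `φ` only. Such
  a function is the limit of its truncations, because its gradient vanishes almost everywhere on
  its zero set (`ae_fderiv_eq_zero_of_eq_zero`).

The Neumann data on `∂B` are determined by the solution and its Dirichlet data, as every Fourier
mode on `∂B` extends to a test function (`HasCauchyData.neumann_unique`); they depend linearly on
the solution, as the Fourier coefficients of smooth functions decay rapidly
(`exists_circleCoeff_decay`), so that the pairings with `H^{-1/2}` and `H^{-3/2}` converge.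
-/

noncomputable section

namespace OneWave

/-! ### Test functions -/

theorem fderiv_apply_mem_testFun {φ : ℂ → ℂ} (h : φ ∈ TestFun) (w : ℂ) :
    (fun x => fderiv ℝ φ x w) ∈ TestFun :=
  ⟨(h.1.fderiv_right (m := ∞) (by simp)).clm_apply contDiff_const, h.2.fderiv_apply ℝ w⟩

theorem d₁_mem_testFun {φ : ℂ → ℂ} (h : φ ∈ TestFun) : d₁ φ ∈ TestFun :=
  fderiv_apply_mem_testFun h 1

theorem d₂_mem_testFun {φ : ℂ → ℂ} (h : φ ∈ TestFun) : d₂ φ ∈ TestFun :=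
  fderiv_apply_mem_testFun h Complex.I

theorem differentiable_of_mem_testFun {φ : ℂ → ℂ} (h : φ ∈ TestFun) : Differentiable ℝ φ :=
  h.1.differentiable (by simp)

theorem mul_mem_testFun {θ φ : ℂ → ℂ} (hθ : ContDiff ℝ ∞ θ) (h : φ ∈ TestFun) :
    θ * φ ∈ TestFun :=
  ⟨hθ.mul h.1, h.2.mul_left⟩

theorem memLp_of_mem_testFun {φ : ℂ → ℂ} (h : φ ∈ TestFun) (p : ℝ≥0∞) (μ : Measure ℂ)
    [IsFiniteMeasureOnCompacts μ] : MemLp φ p μ :=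
  h.1.continuous.memLp_of_hasCompactSupport h.2

theorem exists_norm_le_of_mem_testFun {φ : ℂ → ℂ} (h : φ ∈ TestFun) : ∃ C, ∀ x, ‖φ x‖ ≤ C :=
  h.2.exists_bound_of_continuous h.1.continuous

theorem tsupport_d₁_subset (φ : ℂ → ℂ) : tsupport (d₁ φ) ⊆ tsupport φ :=
  tsupport_fderiv_apply_subset ℝ 1

theorem tsupport_d₂_subset (φ : ℂ → ℂ) : tsupport (d₂ φ) ⊆ tsupport φ :=
  tsupport_fderiv_apply_subset ℝ Complex.I

theorem fderiv_mul_apply {φ ψ : ℂ → ℂ} (hφ : Differentiable ℝ φ) (hψ : Differentiable ℝ ψ)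
    (e : ℂ) : (fun x => fderiv ℝ (φ * ψ) x e) =
      φ * (fun x => fderiv ℝ ψ x e) + (fun x => fderiv ℝ φ x e) * ψ := by
  ext x
  simp only [Pi.mul_apply, Pi.add_apply]
  rw [fderiv_mul (hφ x) (hψ x)]
  simp [mul_comm]

theorem d₁_mul {φ ψ : ℂ → ℂ} (hφ : Differentiable ℝ φ) (hψ : Differentiable ℝ ψ) :
    d₁ (φ * ψ) = φ * d₁ ψ + d₁ φ * ψ :=
  fderiv_mul_apply hφ hψ 1

theorem d₂_mul {φ ψ : ℂ → ℂ} (hφ : Differentiable ℝ φ) (hψ : Differentiable ℝ ψ) :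
    d₂ (φ * ψ) = φ * d₂ ψ + d₂ φ * ψ :=
  fderiv_mul_apply hφ hψ Complex.I

theorem d₁_add {φ ψ : ℂ → ℂ} (hφ : Differentiable ℝ φ) (hψ : Differentiable ℝ ψ) :
    d₁ (φ + ψ) = d₁ φ + d₁ ψ := by
  ext x; simp [d₁, fderiv_add (hφ x) (hψ x)]

theorem d₂_add {φ ψ : ℂ → ℂ} (hφ : Differentiable ℝ φ) (hψ : Differentiable ℝ ψ) :
    d₂ (φ + ψ) = d₂ φ + d₂ ψ := by
  ext x; simp [d₂, fderiv_add (hφ x) (hψ x)]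

theorem d₁_const_smul (a : ℂ) {φ : ℂ → ℂ} (hφ : Differentiable ℝ φ) :
    d₁ (a • φ) = a • d₁ φ := by
  ext x; simp [d₁, fderiv_const_smul (hφ x)]

theorem d₂_const_smul (a : ℂ) {φ : ℂ → ℂ} (hφ : Differentiable ℝ φ) :
    d₂ (a • φ) = a • d₂ φ := by
  ext x; simp [d₂, fderiv_const_smul (hφ x)]

theorem d₁_eq_zero_of_eqOn {φ : ℂ → ℂ} {U : Set ℂ} (hU : IsOpen U) {a : ℂ}
    (h : ∀ x ∈ U, φ x = a) {x : ℂ} (hx : x ∈ U) : d₁ φ x = 0 := by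
  have : φ =ᶠ[nhds x] fun _ => a := by
    filter_upwards [hU.mem_nhds hx] with y hy using h y hy
  simp [d₁, this.fderiv_eq]

theorem d₂_eq_zero_of_eqOn {φ : ℂ → ℂ} {U : Set ℂ} (hU : IsOpen U) {a : ℂ}
    (h : ∀ x ∈ U, φ x = a) {x : ℂ} (hx : x ∈ U) : d₂ φ x = 0 := by
  have : φ =ᶠ[nhds x] fun _ => a := by
    filter_upwards [hU.mem_nhds hx] with y hy using h y hy
  simp [d₂, this.fderiv_eq]

theorem fderiv_apply_eq (φ : ℂ → ℂ) (x w : ℂ) :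
    fderiv ℝ φ x w = w.re * d₁ φ x + w.im * d₂ φ x := by
  have : w = w.re • (1 : ℂ) + w.im • Complex.I := by
    simp [Complex.re_add_im]
  conv_lhs => rw [this]
  rw [map_add, map_smul, map_smul]
  simp [d₁, d₂]

/-- A smooth cutoff function: it equals `1` on a compact set, and is supported in a given open
neighbourhood of that set. -/
theorem exists_cutoff {K U : Set ℂ} (hK : IsCompact K) (hU : IsOpen U) (hKU : K ⊆ U) :
    ∃ χ ∈ TestFun, tsupport χ ⊆ U ∧ ∀ x ∈ K, χ x = 1 := by
  obtain ⟨L, hL, hKL, hLU⟩ := exists_compact_between hK hU hKU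
  obtain ⟨f, hf, -, hfs, hf1⟩ := exists_contMDiff_support_eq_eq_one_iff
    (modelWithCornersSelf ℝ ℂ) (n := ⊤) isOpen_interior hK.isClosed hKL
  have hsupp : Function.support (fun x => ((f x : ℝ) : ℂ)) = interior L := by
    rw [← hfs]; ext x; simp
  have hts : tsupport (fun x => ((f x : ℝ) : ℂ)) ⊆ L := by
    rw [tsupport, hsupp]
    exact closure_minimal interior_subset hL.isClosed
  refine ⟨fun x => (f x : ℂ), ⟨?_, ?_⟩, hts.trans hLU, fun x hx => ?_⟩
  · exact Complex.ofRealCLM.contDiff.comp hf.contDiff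
  · exact hL.of_isClosed_subset (isClosed_tsupport _) hts
  · simp [(hf1 x).1 hx]

/-! ### The trace inequality -/

theorem enorm_sq_le_lintegral_deriv {ψ : ℝ → ℂ} (h : ContDiff ℝ 1 ψ) (hc : HasCompactSupport ψ)
    (s : ℝ) : ‖ψ s‖ₑ ^ 2 ≤ ∫⁻ y, (‖ψ y‖ₑ ^ 2 + ‖deriv ψ y‖ₑ ^ 2) := by
  have h2 : HasCompactSupport (ψ ^ 2) := by
    rw [pow_two]; exact hc.mul_left
  calc ‖ψ s‖ₑ ^ 2 = ‖(ψ ^ 2) s‖ₑ := by simp [enorm_pow]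
    _ ≤ ∫⁻ y in Iic s, ‖deriv (ψ ^ 2) y‖ₑ := h2.enorm_le_lintegral_Ici_deriv (h.pow 2) s
    _ ≤ ∫⁻ y, ‖deriv (ψ ^ 2) y‖ₑ := setLIntegral_le_lintegral _ _
    _ ≤ _ := by
      refine lintegral_mono fun y => ?_
      have hd : DifferentiableAt ℝ ψ y := h.differentiable (by simp) y
      rw [deriv_pow hd]
      simp only [← ofReal_norm, Nat.cast_ofNat, Nat.add_one_sub_one, pow_one]
      rw [← ENNReal.ofReal_pow (norm_nonneg _), ← ENNReal.ofReal_pow (norm_nonneg _),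
        ← ENNReal.ofReal_add (by positivity) (by positivity)]
      refine ENNReal.ofReal_le_ofReal ?_
      simp only [norm_mul, Complex.norm_ofNat]
      nlinarith [sq_nonneg (‖ψ y‖ - ‖deriv ψ y‖)]

theorem measurePreserving_coord {e : ℂ} (he : ‖e‖ = 1) (p : ℂ) :
    MeasurePreserving (fun z : ℝ × ℝ => p + e * (z.1 + z.2 * Complex.I)) volume volume := by
  obtain ⟨a, rfl⟩ : ∃ a : Circle, (a : ℂ) = e :=
    ⟨⟨e, by simp [Submonoid.unitSphere, he]⟩, rfl⟩
  have h1 := Complex.volume_preserving_equiv_real_prod.symm Complex.measurableEquivRealProd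
  have h2 := (rotation a).measurePreserving
  have h3 := measurePreserving_add_left (volume : Measure ℂ) p
  have h4 : (fun z : ℝ × ℝ => p + a * (z.1 + z.2 * Complex.I)) =
      ((fun x => p + x) ∘ rotation a) ∘ Complex.measurableEquivRealProd.symm := by
    funext z
    simp only [Function.comp_apply, Complex.measurableEquivRealProd_symm_apply,
      Complex.mk_eq_add_mul_I, rotation_apply]
  rw [h4]
  exact (h3.comp h2).comp h1

/-- The density of the square of the `H¹(ℝ²)` norm. -/
def h1Density (φ : ℂ → ℂ) (x : ℂ) : ℝ≥0∞ := ‖φ x‖ₑ ^ 2 + ‖d₁ φ x‖ₑ ^ 2 + ‖d₂ φ x‖ₑ ^ 2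

theorem measurable_h1Density {φ : ℂ → ℂ} (h : φ ∈ TestFun) : Measurable (h1Density φ) := by
  have h0 := h.1.continuous.measurable
  have h1 := (d₁_mem_testFun h).1.continuous.measurable
  have h2 := (d₂_mem_testFun h).1.continuous.measurable
  unfold h1Density
  fun_prop

/-- The trace inequality on the graph of an arbitrary function: the one-dimensional inequality
is integrated over the lines that cross the graph. -/
theorem lintegral_graph_le {e : ℂ} (he : ‖e‖ = 1) (p : ℂ) (γ : ℝ → ℝ) {φ : ℂ → ℂ}
    (h : φ ∈ TestFun) :
    ∫⁻ s : ℝ, ‖φ (p + e * (s + γ s * Complex.I))‖ₑ ^ 2 ≤ 2 * ∫⁻ x, h1Density φ x := by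
  have hm := measurePreserving_coord he p
  rw [← hm.lintegral_comp (measurable_h1Density h), Measure.volume_eq_prod, lintegral_prod
    (fun z : ℝ × ℝ => h1Density φ (p + e * (z.1 + z.2 * Complex.I)))
    ((measurable_h1Density h).comp hm.measurable).aemeasurable,
    ← lintegral_const_mul' _ _ (by simp)]
  refine lintegral_mono fun s => ?_
  rw [← lintegral_const_mul' _ _ (by simp)]
  have hd : ∀ y : ℝ, HasDerivAt (fun y : ℝ => p + e * (s + y * Complex.I)) (e * Complex.I) y := by
    intro y
    simpa using ((((hasDerivAt_id y).ofReal_comp.mul_const Complex.I).const_add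
      (s : ℂ)).const_mul e).const_add p
  have hcd : ContDiff ℝ 1 (fun y : ℝ => p + e * (s + y * Complex.I)) := by
    have : ContDiff ℝ 1 (fun y : ℝ => (y : ℂ)) := Complex.ofRealCLM.contDiff
    fun_prop
  have hemb : Topology.IsClosedEmbedding (fun y : ℝ => p + e * (s + y * Complex.I)) := by
    apply Isometry.isClosedEmbedding
    refine Isometry.of_dist_eq fun x y => ?_
    rw [dist_eq_norm, dist_eq_norm]
    have : p + e * (s + x * Complex.I) - (p + e * (s + y * Complex.I)) =
      e * ((x - y : ℝ) * Complex.I) := by push_cast; ring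
    rw [this]
    simp [he, -Complex.ofReal_sub]
  refine (enorm_sq_le_lintegral_deriv (ψ := fun y : ℝ => φ (p + e * (s + y * Complex.I)))
    ((h.1.of_le (by simp)).comp hcd) (h.2.comp_isClosedEmbedding hemb) (γ s)).trans ?_
  refine lintegral_mono fun y => ?_
  have hderiv : deriv (fun y : ℝ => φ (p + e * (s + y * Complex.I))) y =
      fderiv ℝ φ (p + e * (s + y * Complex.I)) (e * Complex.I) :=
    ((differentiable_of_mem_testFun h _).hasFDerivAt.comp_hasDerivAt y (hd y)).deriv
  simp only [hderiv, h1Density]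
  set z := p + e * (s + y * Complex.I)
  have hre : |(e * Complex.I).re| ≤ 1 := (Complex.abs_re_le_norm _).trans (by simp [he])
  have him : |(e * Complex.I).im| ≤ 1 := (Complex.abs_im_le_norm _).trans (by simp [he])
  have hn : ‖fderiv ℝ φ z (e * Complex.I)‖ ≤ ‖d₁ φ z‖ + ‖d₂ φ z‖ := by
    rw [fderiv_apply_eq]
    refine (norm_add_le _ _).trans (add_le_add ?_ ?_)
    · rw [norm_mul, Complex.norm_real, Real.norm_eq_abs]
      exact mul_le_of_le_one_left (norm_nonneg _) hre
    · rw [norm_mul, Complex.norm_real, Real.norm_eq_abs]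
      exact mul_le_of_le_one_left (norm_nonneg _) him
  simp only [← ofReal_norm]
  simp only [← ENNReal.ofReal_pow (norm_nonneg _)]
  rw [show (2 : ℝ≥0∞) = ENNReal.ofReal 2 by simp]
  rw [← ENNReal.ofReal_add (by positivity) (by positivity),
    ← ENNReal.ofReal_add (by positivity) (by positivity),
    ← ENNReal.ofReal_add (by positivity) (by positivity),
    ← ENNReal.ofReal_mul (by positivity)]
  refine ENNReal.ofReal_le_ofReal ?_
  have := pow_le_pow_left₀ (norm_nonneg _) hn 2
  nlinarith [sq_nonneg (‖d₁ φ z‖ - ‖d₂ φ z‖), sq_nonneg ‖φ z‖]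

/-- Near one of its points, the boundary of a Lipschitz domain lies on a Lipschitz graph, whose
arc length is bounded by a multiple of the length of its projection. -/
theorem IsLipschitzDomain.exists_local_bound {Ω : Set ℂ} (hΩ : IsLipschitzDomain Ω) {p : ℂ}
    (hp : p ∈ frontier Ω) : ∃ r > 0, ∃ C : ℝ≥0∞, C ≠ ⊤ ∧ ∀ φ ∈ TestFun,
      ∫⁻ x in frontier Ω ∩ ball p r, ‖φ x‖ₑ ^ 2 ∂(Measure.hausdorffMeasure 1) ≤
        C * ∫⁻ x, h1Density φ x := by
  obtain ⟨e, he, r, hr, K, γ, hγ, hg⟩ := hΩ.graph p hp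
  have he0 : e ≠ 0 := by rintro rfl; simp at he
  set Γ : ℝ → ℂ := fun s => p + e * (s + γ s * Complex.I) with hΓ
  have hΓL : LipschitzWith (1 + K) Γ := by
    refine LipschitzWith.of_dist_le_mul fun x y => ?_
    rw [dist_eq_norm]
    have : Γ x - Γ y = e * ((x - y : ℝ) + (γ x - γ y : ℝ) * Complex.I) := by
      simp only [hΓ]; push_cast; ring
    rw [this, norm_mul, he, one_mul]
    refine (norm_add_le _ _).trans ?_
    have h1 := hγ.dist_le_mul x y
    rw [Real.dist_eq] at h1
    rw [Complex.norm_real, norm_mul, Complex.norm_real, Complex.norm_I, mul_one]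
    simp only [Real.norm_eq_abs, Real.dist_eq, NNReal.coe_add, NNReal.coe_one] at h1 ⊢
    linarith
  have hsub : frontier Ω ∩ ball p r ⊆ range Γ := by
    rintro x ⟨hx, hxr⟩
    refine ⟨((x - p) / e).re, ?_⟩
    have hxΩ : x ∉ Ω := by
      rw [hΩ.isOpen.frontier_eq] at hx; exact hx.2
    have h1 : ((x - p) / e).im ≤ γ (((x - p) / e).re) :=
      not_lt.1 fun hlt => hxΩ ((hg x hxr).2 hlt)
    have h2 : γ (((x - p) / e).re) ≤ ((x - p) / e).im := by
      by_contra! hlt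
      have hcont : Continuous fun y : ℂ => γ (((y - p) / e).re) - ((y - p) / e).im := by
        have := hγ.continuous
        fun_prop
      have hev : ∀ᶠ y in nhds x, y ∉ Ω := by
        filter_upwards [isOpen_ball.mem_nhds hxr,
          hcont.continuousAt.eventually (lt_mem_nhds (sub_pos.2 hlt))] with y hy hy2 hyΩ
        have := (hg y hy).1 hyΩ
        linarith
      have : x ∈ closure Ω := frontier_subset_closure hx
      rw [mem_closure_iff_frequently] at this
      exact this hev
    have h3 : γ (((x - p) / e).re) = ((x - p) / e).im := le_antisymm h2 h1
    simp only [hΓ]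
    rw [h3, Complex.re_add_im]
    field_simp
    ring
  have hmeas : Measurable Γ := hΓL.continuous.measurable
  have hle : (Measure.hausdorffMeasure 1 : Measure ℂ).restrict (frontier Ω ∩ ball p r) ≤
      ((1 + K : NNReal) : ℝ≥0∞) • (volume : Measure ℝ).map Γ := by
    refine Measure.le_iff.2 fun A hA => ?_
    rw [Measure.restrict_apply hA, Measure.smul_apply, Measure.map_apply hmeas hA]
    have : A ∩ (frontier Ω ∩ ball p r) ⊆ Γ '' (Γ ⁻¹' A) := by
      rw [image_preimage_eq_inter_range]
      exact inter_subset_inter_right _ hsub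
    refine (measure_mono this).trans ?_
    have := hΓL.hausdorffMeasure_image_le (d := 1) zero_le_one (Γ ⁻¹' A)
    simpa [hausdorffMeasure_real] using this
  refine ⟨r, hr, (1 + K : NNReal) * 2, ENNReal.mul_ne_top ENNReal.coe_ne_top (by simp),
    fun φ h => ?_⟩
  have hφm : Measurable fun x => ‖φ x‖ₑ ^ 2 := by
    have := h.1.continuous.measurable
    fun_prop
  calc _ ≤ ∫⁻ x, ‖φ x‖ₑ ^ 2 ∂(((1 + K : NNReal) : ℝ≥0∞) • (volume : Measure ℝ).map Γ) :=
        lintegral_mono' hle le_rfl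
    _ = ((1 + K : NNReal) : ℝ≥0∞) * ∫⁻ s : ℝ, ‖φ (Γ s)‖ₑ ^ 2 := by
        rw [lintegral_smul_measure, lintegral_map hφm hmeas, smul_eq_mul]
    _ ≤ _ := by
        rw [mul_assoc]
        exact mul_le_mul_right (lintegral_graph_le he p γ h) _

theorem IsLipschitzDomain.isCompact_frontier {Ω : Set ℂ} (hΩ : IsLipschitzDomain Ω) :
    IsCompact (frontier Ω) :=
  hΩ.isBounded.isCompact_closure.of_isClosed_subset isClosed_frontier frontier_subset_closure

/-- The trace inequality, with squared norms. -/
theorem IsLipschitzDomain.exists_lintegral_bdry_le {Ω : Set ℂ} (hΩ : IsLipschitzDomain Ω) :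
    ∃ C : ℝ≥0∞, C ≠ ⊤ ∧ ∀ φ ∈ TestFun,
      ∫⁻ x, ‖φ x‖ₑ ^ 2 ∂(bdry Ω) ≤ C * ∫⁻ x, h1Density φ x := by
  have key : ∃ C : ℝ≥0∞, C ≠ ⊤ ∧ ∀ φ ∈ TestFun,
      ∫⁻ x in frontier Ω ∩ frontier Ω, ‖φ x‖ₑ ^ 2 ∂(Measure.hausdorffMeasure 1) ≤
        C * ∫⁻ x, h1Density φ x := by
    refine hΩ.isCompact_frontier.induction_on (p := fun s => ∃ C : ℝ≥0∞, C ≠ ⊤ ∧ ∀ φ ∈ TestFun,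
      ∫⁻ x in frontier Ω ∩ s, ‖φ x‖ₑ ^ 2 ∂(Measure.hausdorffMeasure 1) ≤
        C * ∫⁻ x, h1Density φ x) ⟨0, by simp, fun φ _ => by simp⟩ ?_ ?_ ?_
    · rintro s t hst ⟨C, hC, h⟩
      exact ⟨C, hC, fun φ hφ => (lintegral_mono_set (inter_subset_inter_right _ hst)).trans
        (h φ hφ)⟩
    · rintro s t ⟨C, hC, h⟩ ⟨C', hC', h'⟩
      refine ⟨C + C', ENNReal.add_ne_top.2 ⟨hC, hC'⟩, fun φ hφ => ?_⟩
      rw [inter_union_distrib_left, add_mul]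
      exact (lintegral_union_le _ _ _).trans (add_le_add (h φ hφ) (h' φ hφ))
    · intro p hp
      obtain ⟨r, hr, C, hC, h⟩ := hΩ.exists_local_bound hp
      exact ⟨ball p r, mem_nhdsWithin_of_mem_nhds (ball_mem_nhds p hr), C, hC, h⟩
  simpa [bdry] using key

/-- The (equivalent) `H¹` norm of a function together with its weak gradient. -/
def sobNorm (v p q : ℂ → ℂ) : ℝ≥0∞ :=
  eLpNorm v 2 volume + eLpNorm p 2 volume + eLpNorm q 2 volume

theorem eLpNorm_two_sq (v : ℂ → ℂ) (μ : Measure ℂ) :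
    eLpNorm v 2 μ ^ 2 = ∫⁻ x, ‖v x‖ₑ ^ 2 ∂μ := by
  have := eLpNorm_nnreal_pow_eq_lintegral (f := v) (μ := μ) (p := 2) (by simp)
  simpa [ENNReal.rpow_two] using this

theorem lintegral_h1Density {φ : ℂ → ℂ} (h : φ ∈ TestFun) :
    ∫⁻ x, h1Density φ x =
      eLpNorm φ 2 volume ^ 2 + eLpNorm (d₁ φ) 2 volume ^ 2 + eLpNorm (d₂ φ) 2 volume ^ 2 := by
  have h0 := h.1.continuous.measurable
  have h1 := (d₁_mem_testFun h).1.continuous.measurable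
  have h2 := (d₂_mem_testFun h).1.continuous.measurable
  simp only [eLpNorm_two_sq, h1Density]
  rw [lintegral_add_right _ (by fun_prop), lintegral_add_right _ (by fun_prop)]

theorem IsLipschitzDomain.isFiniteMeasure_bdry {Ω : Set ℂ} (hΩ : IsLipschitzDomain Ω) :
    IsFiniteMeasure (bdry Ω) := by
  obtain ⟨C, hC, h⟩ := hΩ.exists_lintegral_bdry_le
  obtain ⟨χ, hχ, -, h1⟩ := exists_cutoff hΩ.isCompact_frontier isOpen_univ (subset_univ _)
  have h2 := h χ hχ
  have h3 : ∫⁻ x, ‖χ x‖ₑ ^ 2 ∂(bdry Ω) = bdry Ω univ := by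
    have : ∀ᵐ x ∂(bdry Ω), ‖χ x‖ₑ ^ 2 = 1 := by
      filter_upwards [ae_restrict_mem isClosed_frontier.measurableSet] with x hx
      simp [h1 x hx]
    rw [lintegral_congr_ae this]
    simp
  refine ⟨h3 ▸ h2.trans_lt (ENNReal.mul_lt_top hC.lt_top ?_)⟩
  rw [lintegral_h1Density hχ]
  have a := (memLp_of_mem_testFun hχ 2 volume).2
  have b := (memLp_of_mem_testFun (d₁_mem_testFun hχ) 2 volume).2
  have c := (memLp_of_mem_testFun (d₂_mem_testFun hχ) 2 volume).2
  exact ENNReal.add_lt_top.2 ⟨ENNReal.add_lt_top.2 ⟨ENNReal.pow_lt_top a, ENNReal.pow_lt_top b⟩,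
    ENNReal.pow_lt_top c⟩

/-- The trace inequality `‖φ‖_{L²(∂Ω)} ≤ C ‖φ‖_{H¹(ℝ²)}` on the boundary of a Lipschitz domain. -/
theorem IsLipschitzDomain.exists_trace_le {Ω : Set ℂ} (hΩ : IsLipschitzDomain Ω) :
    ∃ C : ℝ≥0∞, C ≠ ⊤ ∧ ∀ φ ∈ TestFun,
      eLpNorm φ 2 (bdry Ω) ≤ C * sobNorm φ (d₁ φ) (d₂ φ) := by
  obtain ⟨C, hC, h⟩ := hΩ.exists_lintegral_bdry_le
  refine ⟨1 + C, by simp [hC], fun φ hφ => ?_⟩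
  rw [← ENNReal.pow_le_pow_left_iff two_ne_zero, eLpNorm_two_sq]
  refine (h φ hφ).trans ?_
  rw [lintegral_h1Density hφ, mul_pow, sobNorm]
  gcongr
  · calc C ≤ (1 + C) * 1 := by simp
      _ ≤ (1 + C) ^ 2 := by rw [pow_two]; gcongr; simp
  · generalize eLpNorm φ 2 volume = a
    generalize eLpNorm (d₁ φ) 2 volume = b
    generalize eLpNorm (d₂ φ) 2 volume = c
    calc a ^ 2 + b ^ 2 + c ^ 2 ≤ a ^ 2 + b ^ 2 + c ^ 2 + 2 * (a * b + a * c + b * c) :=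
          le_self_add
      _ = (a + b + c) ^ 2 := by ring

theorem eLpNorm_le_h1Norm {φ : ℂ → ℂ} (h : φ ∈ TestFun) :
    eLpNorm φ 2 volume ≤ ENNReal.ofReal (h1Norm φ) ∧
    eLpNorm (d₁ φ) 2 volume ≤ ENNReal.ofReal (h1Norm φ) ∧
    eLpNorm (d₂ φ) 2 volume ≤ ENNReal.ofReal (h1Norm φ) := by
  have hsq : ENNReal.ofReal (h1Norm φ) ^ 2 = ∫⁻ x, h1Density φ x := by
    rw [h1Norm, ← ENNReal.ofReal_pow (Real.sqrt_nonneg _), Real.sq_sqrt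
      (integral_nonneg fun x => by positivity), ofReal_integral_eq_lintegral_ofReal]
    · refine lintegral_congr fun x => ?_
      rw [h1Density, ENNReal.ofReal_add (by positivity) (by positivity),
        ENNReal.ofReal_add (by positivity) (by positivity)]
      simp only [ENNReal.ofReal_pow (norm_nonneg _), ofReal_norm]
    · have a := (memLp_of_mem_testFun h 2 volume).integrable_norm_pow (by simp)
      have b := (memLp_of_mem_testFun (d₁_mem_testFun h) 2 volume).integrable_norm_pow (by simp)
      have c := (memLp_of_mem_testFun (d₂_mem_testFun h) 2 volume).integrable_norm_pow (by simp)
      exact (a.add b).add c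
    · exact Filter.Eventually.of_forall fun x => by positivity
  rw [lintegral_h1Density h] at hsq
  rw [← ENNReal.pow_le_pow_left_iff two_ne_zero, ← ENNReal.pow_le_pow_left_iff
    (a := eLpNorm (d₁ φ) 2 volume) two_ne_zero, ← ENNReal.pow_le_pow_left_iff
    (a := eLpNorm (d₂ φ) 2 volume) two_ne_zero, hsq]
  refine ⟨?_, ?_, ?_⟩
  · rw [add_assoc]; exact le_self_add
  · exact le_add_right le_add_self
  · exact le_add_self

/-! ### Mollification and density of test functions in `H¹(ℝ²)` -/

open ContinuousLinearMap in
/-- Convolution with a probability density does not increase the `L²` norm. -/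
theorem eLpNorm_convolution_le {ρ : ℂ → ℝ} (hρc : Continuous ρ) (hρs : HasCompactSupport ρ)
    (hρ0 : ∀ x, 0 ≤ ρ x) (hρ1 : ∫ x, ρ x = 1) {h : ℂ → ℂ} (hh : AEStronglyMeasurable h volume) :
    eLpNorm (convolution ρ h (lsmul ℝ ℝ) volume) 2 volume ≤ eLpNorm h 2 volume := by
  have hm : Measurable fun t => ‖ρ t‖ₑ := hρc.measurable.enorm
  set ν : Measure ℂ := volume.withDensity fun t => ‖ρ t‖ₑ with hν
  have hmass : ∫⁻ t, ‖ρ t‖ₑ = 1 := by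
    have h1 := ofReal_integral_eq_lintegral_ofReal (μ := volume)
      (hρc.integrable_of_hasCompactSupport hρs)
      (Filter.Eventually.of_forall hρ0)
    rw [hρ1, ENNReal.ofReal_one] at h1
    rw [h1]
    refine lintegral_congr fun t => ?_
    rw [Real.enorm_eq_ofReal (hρ0 t)]
  have : IsProbabilityMeasure ν := ⟨by rw [hν, withDensity_apply _ MeasurableSet.univ]; simpa⟩
  have hac : ν ≪ volume := withDensity_absolutelyContinuous _ _
  have hsub : ∀ x : ℂ, AEStronglyMeasurable (fun t => h (x - t)) volume := fun x =>
    hh.comp_measurePreserving (Measure.measurePreserving_sub_left volume x)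
  have hpt : ∀ x, ‖convolution ρ h (lsmul ℝ ℝ) volume x‖ₑ ^ 2 ≤
      ∫⁻ t, ‖ρ t‖ₑ * ‖h (x - t)‖ₑ ^ 2 := by
    intro x
    calc ‖convolution ρ h (lsmul ℝ ℝ) volume x‖ₑ ^ 2
        ≤ (∫⁻ t, ‖ρ t‖ₑ * ‖h (x - t)‖ₑ) ^ 2 := by
          gcongr
          refine (enorm_integral_le_lintegral_enorm _).trans_eq (lintegral_congr fun t => ?_)
          rw [lsmul_apply, enorm_smul]
      _ = eLpNorm (fun t => h (x - t)) 1 ν ^ 2 := by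
          rw [eLpNorm_one_eq_lintegral_enorm, hν, lintegral_withDensity_eq_lintegral_mul₀
            hm.aemeasurable (hsub x).enorm]
          rfl
      _ ≤ eLpNorm (fun t => h (x - t)) 2 ν ^ 2 := by
          gcongr
          exact eLpNorm_le_eLpNorm_of_exponent_le (by norm_num) ((hsub x).mono_ac hac)
      _ = _ := by
          rw [eLpNorm_two_sq, hν, lintegral_withDensity_eq_lintegral_mul₀
            hm.aemeasurable ((hsub x).enorm.pow_const 2)]
          rfl
  rw [← ENNReal.pow_le_pow_left_iff two_ne_zero, eLpNorm_two_sq, eLpNorm_two_sq]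
  refine (lintegral_mono hpt).trans ?_
  have hprod : AEMeasurable (Function.uncurry fun x t : ℂ => ‖ρ t‖ₑ * ‖h (x - t)‖ₑ ^ 2)
      (volume.prod volume) := by
    refine (hm.comp measurable_snd).aemeasurable.mul ?_
    refine AEMeasurable.pow_const (AEStronglyMeasurable.enorm ?_) 2
    exact hh.comp_quasiMeasurePreserving
      (quasiMeasurePreserving_sub_of_right_invariant volume volume)
  rw [lintegral_lintegral_swap hprod]
  have : ∀ t, ∫⁻ x, ‖ρ t‖ₑ * ‖h (x - t)‖ₑ ^ 2 = ‖ρ t‖ₑ * ∫⁻ x, ‖h x‖ₑ ^ 2 := by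
    intro t
    rw [lintegral_const_mul' _ _ (by simp),
      lintegral_sub_right_eq_self (fun x => ‖h x‖ₑ ^ 2) t]
  simp only [this]
  rw [lintegral_mul_const _ hm, hmass, one_mul]

open ContinuousLinearMap in
/-- The mollifications of an `L²` function converge to it in `L²`. -/
theorem exists_eLpNorm_sub_convolution_le {f : ℂ → ℂ} (hf : MemLp f 2 volume) {ε : ℝ≥0∞}
    (hε : ε ≠ 0) : ∃ δ > 0, ∀ b : ContDiffBump (0 : ℂ), b.rOut < δ →
      eLpNorm (f - convolution (b.normed volume) f (lsmul ℝ ℝ) volume) 2 volume ≤ ε := by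
  have hε3 : ε / 3 ≠ 0 := by simp [hε]
  obtain ⟨g, hgs, hfg, hgc, hgm⟩ := hf.exists_hasCompactSupport_eLpNorm_sub_le (by simp) hε3
  set K := cthickening 1 (tsupport g) with hK
  have hKc : IsCompact K := hgs.isCompact.cthickening
  have hKfin : volume K < ⊤ := hKc.measure_lt_top
  obtain ⟨η, hη, hηK⟩ : ∃ η : ℝ, 0 < η ∧
      volume K ^ ((2 : ℝ≥0∞).toReal)⁻¹ * ENNReal.ofReal η ≤ ε / 3 := by
    set M := volume K ^ ((2 : ℝ≥0∞).toReal)⁻¹ with hM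
    have hMt : M ≠ ⊤ := ENNReal.rpow_ne_top_of_nonneg (by positivity) hKfin.ne
    rcases eq_or_ne ε ⊤ with rfl | hεt
    · exact ⟨1, one_pos, by simp [ENNReal.top_div]⟩
    rcases eq_or_ne M 0 with h0 | h0
    · exact ⟨1, one_pos, by simp [h0]⟩
    have ht : ε / 3 / M ≠ ⊤ :=
      ENNReal.div_ne_top (ENNReal.div_ne_top hεt (by simp)) h0
    refine ⟨(ε / 3 / M).toReal, ENNReal.toReal_pos (ENNReal.div_ne_zero.2 ⟨hε3, hMt⟩) ht, ?_⟩
    rw [ENNReal.ofReal_toReal ht, ENNReal.mul_div_cancel h0 hMt]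
  obtain ⟨δ, hδ, hδg⟩ := Metric.uniformContinuous_iff.1
    (hgs.uniformContinuous_of_continuous hgc) η hη
  refine ⟨min δ 1, lt_min hδ one_pos, fun b hb => ?_⟩
  have hb1 : b.rOut < δ := hb.trans_le (min_le_left _ _)
  have hb2 : b.rOut < 1 := hb.trans_le (min_le_right _ _)
  set ρ := b.normed volume with hρ
  have hρc : Continuous ρ := b.continuous_normed
  have hρs : HasCompactSupport ρ := b.hasCompactSupport_normed
  have hsupp : Function.support ρ = ball 0 b.rOut := b.support_normed_eq
  have hsplit : f - convolution ρ f (lsmul ℝ ℝ) volume =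
      (f - g) + (g - convolution ρ g (lsmul ℝ ℝ) volume) +
        (convolution ρ g (lsmul ℝ ℝ) volume - convolution ρ f (lsmul ℝ ℝ) volume) := by
    abel
  have hex : ∀ k : ℂ → ℂ, LocallyIntegrable k volume → ConvolutionExists ρ k
      (lsmul ℝ ℝ : ℝ →L[ℝ] ℂ →L[ℝ] ℂ) volume := fun k hk =>
    hρs.convolutionExists_left _ hρc hk
  have hfl : LocallyIntegrable f volume := hf.locallyIntegrable (by norm_num)
  have hgl : LocallyIntegrable g volume := hgc.locallyIntegrable
  have hconv : convolution ρ g (lsmul ℝ ℝ) volume - convolution ρ f (lsmul ℝ ℝ) volume =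
      convolution ρ (g - f) (lsmul ℝ ℝ) volume := by
    rw [sub_eq_add_neg g f, (hex g hgl).distrib_add (hex (-f) hfl.neg), sub_eq_add_neg]
    congr 1
    ext x
    simp [convolution, integral_neg]
  have h3 : eLpNorm (convolution ρ (g - f) (lsmul ℝ ℝ) volume) 2 volume ≤ ε / 3 := by
    refine (eLpNorm_convolution_le hρc hρs (fun x => b.nonneg_normed x) (b.integral_normed)
      (hgm.1.sub hf.1)).trans ?_
    rwa [eLpNorm_sub_comm]
  have h2 : eLpNorm (g - convolution ρ g (lsmul ℝ ℝ) volume) 2 volume ≤ ε / 3 := by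
    have hzero : ∀ x ∉ K, (g - convolution ρ g (lsmul ℝ ℝ) volume) x = 0 := by
      intro x hx
      have hnear : ∀ t ∈ ball (0 : ℂ) b.rOut, g (x - t) = 0 := by
        intro t ht
        by_contra hne
        apply hx
        rw [hK]
        refine mem_cthickening_of_dist_le x (x - t) 1 _ (subset_tsupport _ hne) ?_
        rw [dist_eq_norm]
        simp only [sub_sub_cancel]
        rw [mem_ball_zero_iff] at ht
        linarith
      have hg0 : g x = 0 := by
        simpa using hnear 0 (mem_ball_self b.rOut_pos)
      have hc0 : convolution ρ g (lsmul ℝ ℝ) volume x = 0 := by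
        rw [convolution]
        refine integral_eq_zero_of_ae (Filter.Eventually.of_forall fun t => ?_)
        by_cases ht : t ∈ ball (0 : ℂ) b.rOut
        · simp [hnear t ht]
        · rw [← hsupp, Function.notMem_support] at ht
          simp [ht]
      simp [hg0, hc0]
    have hbd : ∀ x, ‖(g - convolution ρ g (lsmul ℝ ℝ) volume) x‖ ≤ η := by
      intro x
      rw [Pi.sub_apply, ← dist_eq_norm, dist_comm]
      refine dist_convolution_le hη.le hsupp.subset (fun x => b.nonneg_normed x)
        b.integral_normed hgc.aestronglyMeasurable fun y hy => ?_
      exact (hδg (lt_trans (mem_ball.1 hy) hb1)).le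
    have hind : (g - convolution ρ g (lsmul ℝ ℝ) volume) =
        K.indicator (g - convolution ρ g (lsmul ℝ ℝ) volume) := by
      ext x
      by_cases hx : x ∈ K
      · rw [indicator_of_mem hx]
      · rw [indicator_of_notMem hx, hzero x hx]
    rw [hind, eLpNorm_indicator_eq_eLpNorm_restrict hKc.measurableSet]
    refine (eLpNorm_le_of_ae_bound (Filter.Eventually.of_forall hbd)).trans ?_
    rwa [Measure.restrict_apply_univ]
  have hgm' : AEStronglyMeasurable (convolution ρ g (lsmul ℝ ℝ) volume) volume :=
    (hρs.continuous_convolution_left _ hρc hgl).aestronglyMeasurable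
  have hfm' : AEStronglyMeasurable (convolution ρ (g - f) (lsmul ℝ ℝ) volume) volume :=
    (hρs.continuous_convolution_left _ hρc (hgl.sub hfl)).aestronglyMeasurable
  rw [hsplit, hconv]
  calc _ ≤ ε / 3 + ε / 3 + ε / 3 := by
        refine (eLpNorm_add_le ((hf.1.sub hgm.1).add (hgm.1.sub hgm')) hfm'
          (by norm_num)).trans (add_le_add ?_ h3)
        exact (eLpNorm_add_le (hf.1.sub hgm.1) (hgm.1.sub hgm') (by norm_num)).trans
          (add_le_add hfg h2)
    _ = ε := ENNReal.add_thirds ε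

open ContinuousLinearMap in
/-- A convolution with a test function takes the weak derivative to the classical one. -/
theorem fderiv_convolution_eq {ρ : ℂ → ℝ} (hρ : ContDiff ℝ ∞ ρ) (hρs : HasCompactSupport ρ)
    {w P : ℂ → ℂ} (hw : LocallyIntegrable w volume) (e : ℂ)
    (h : ∀ φ ∈ TestFun, (∫ x, w x * fderiv ℝ φ x e) = -∫ x, P x * φ x) (x : ℂ) :
    fderiv ℝ (convolution ρ w (lsmul ℝ ℝ) volume) x e =
      convolution ρ P (lsmul ℝ ℝ) volume x := by
  set L : ℝ →L[ℝ] ℂ →L[ℝ] ℂ := lsmul ℝ ℝ with hL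
  have hflip : ∀ k : ℂ → ℂ, convolution ρ k L volume = convolution k ρ L.flip volume :=
    fun k => (convolution_flip (L := L)).symm
  rw [hflip, hflip, (hρs.hasFDerivAt_convolution_right L.flip hw (hρ.of_le (by simp)) x).fderiv,
    convolution_precompR_apply L.flip hw (hρs.fderiv ℝ)
      (hρ.continuous_fderiv (by simp)) x e]
  set ψ : ℂ → ℂ := fun t => (ρ (x - t) : ℂ) with hψ
  have hψt : ψ ∈ TestFun := by
    refine ⟨Complex.ofRealCLM.contDiff.comp (hρ.comp (contDiff_const.sub contDiff_id)), ?_⟩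
    have h1 : HasCompactSupport fun t => ρ (x - t) :=
      hρs.comp_homeomorph (Homeomorph.subLeft x)
    exact h1.comp_left (g := fun r : ℝ => (r : ℂ)) (by simp)
  have hd : ∀ t, fderiv ℝ ψ t e = -((fderiv ℝ ρ (x - t) e : ℝ) : ℂ) := by
    intro t
    have h1 : HasFDerivAt (fun t : ℂ => x - t) (-ContinuousLinearMap.id ℝ ℂ) t :=
      (hasFDerivAt_id t).const_sub x
    have h2 := (hρ.differentiable (by simp) (x - t)).hasFDerivAt.comp t h1
    have h3 := (Complex.ofRealCLM.hasFDerivAt (x := ρ (x - t))).comp t h2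
    have h4 : fderiv ℝ ψ t = _ := h3.fderiv
    rw [h4]
    simp
  have key := h ψ hψt
  simp only [hd, mul_neg, integral_neg, neg_inj] at key
  simp only [convolution, hL, flip_apply, lsmul_apply, Complex.real_smul]
  convert key using 3 <;> simp [hψ, mul_comm]

open ContinuousLinearMap in
/-- Test functions are dense in the compactly supported functions in `H¹(ℝ²)`. -/
theorem exists_testFun_sobNorm_sub_le {w P Q : ℂ → ℂ} (hw : MemLp w 2 volume)
    (hP : MemLp P 2 volume) (hQ : MemLp Q 2 volume) (hs : HasCompactSupport w)
    (hg : HasWeakGradient univ w P Q) {ε : ℝ≥0∞} (hε : ε ≠ 0) :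
    ∃ φ ∈ TestFun, sobNorm (w - φ) (P - d₁ φ) (Q - d₂ φ) ≤ ε := by
  have hε3 : ε / 3 ≠ 0 := by simp [hε]
  obtain ⟨δ₀, hδ₀, h₀⟩ := exists_eLpNorm_sub_convolution_le hw hε3
  obtain ⟨δ₁, hδ₁, h₁⟩ := exists_eLpNorm_sub_convolution_le hP hε3
  obtain ⟨δ₂, hδ₂, h₂⟩ := exists_eLpNorm_sub_convolution_le hQ hε3
  obtain ⟨δ, hδ, hδ'⟩ := exists_between (lt_min hδ₀ (lt_min hδ₁ hδ₂))
  rw [lt_min_iff, lt_min_iff] at hδ'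
  let b : ContDiffBump (0 : ℂ) := ⟨δ / 2, δ, half_pos hδ, half_lt_self hδ⟩
  have hbs : HasCompactSupport (b.normed volume) := b.hasCompactSupport_normed
  have hbc : ContDiff ℝ ∞ (b.normed volume) := b.contDiff_normed
  have hwl : LocallyIntegrable w volume := hw.locallyIntegrable (by norm_num)
  have hd₁ : d₁ (convolution (b.normed volume) w (lsmul ℝ ℝ) volume) =
      convolution (b.normed volume) P (lsmul ℝ ℝ) volume := by
    ext x
    refine fderiv_convolution_eq hbc hbs hwl 1 (fun φ hφ => ?_) x
    have := (hg φ hφ (subset_univ _)).1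
    simp only [setIntegral_univ] at this
    exact this
  have hd₂ : d₂ (convolution (b.normed volume) w (lsmul ℝ ℝ) volume) =
      convolution (b.normed volume) Q (lsmul ℝ ℝ) volume := by
    ext x
    refine fderiv_convolution_eq hbc hbs hwl Complex.I (fun φ hφ => ?_) x
    have := (hg φ hφ (subset_univ _)).2
    simp only [setIntegral_univ] at this
    exact this
  refine ⟨convolution (b.normed volume) w (lsmul ℝ ℝ) volume,
    ⟨hbs.contDiff_convolution_left _ hbc hwl, hbs.convolution _ hs⟩, ?_⟩
  rw [sobNorm, hd₁, hd₂]
  exact (add_le_add (add_le_add (h₀ b hδ'.1) (h₁ b hδ'.2.1)) (h₂ b hδ'.2.2)).trans_eq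
    (ENNReal.add_thirds ε)

/-! ### The pairing on the circle -/

/-- The coefficient `∫_0^{2π} h(θ) e^{inθ} dθ`. -/
def circleCoeff (h : ℝ → ℂ) (n : ℤ) : ℂ :=
  ∫ θ in (0 : ℝ)..2 * Real.pi, h θ * Complex.exp (n * θ * Complex.I)

theorem hasDerivAt_exp_mode (n : ℤ) (θ : ℝ) :
    HasDerivAt (fun θ : ℝ => Complex.exp (n * θ * Complex.I))
      (Complex.exp (n * θ * Complex.I) * (n * Complex.I)) θ := by
  have h1 : HasDerivAt (fun θ : ℝ => (n : ℂ) * θ * Complex.I) ((n : ℂ) * Complex.I) θ := by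
    simpa using (((hasDerivAt_id θ).ofReal_comp.const_mul (n : ℂ)).mul_const Complex.I)
  exact h1.cexp

theorem continuous_exp_mode (n : ℤ) :
    Continuous (fun θ : ℝ => Complex.exp (n * θ * Complex.I)) := by fun_prop

theorem circleCoeff_deriv {h : ℝ → ℂ} (hh : ContDiff ℝ ∞ h)
    (hp : Function.Periodic h (2 * Real.pi)) (n : ℤ) :
    circleCoeff (deriv h) n = -(n * Complex.I) * circleCoeff h n := by
  have hc : Continuous (deriv h) := hh.continuous_deriv (by simp)
  have key := intervalIntegral.integral_deriv_mul_eq_sub (a := 0) (b := 2 * Real.pi)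
    (u := h) (u' := deriv h) (v := fun θ : ℝ => Complex.exp (n * θ * Complex.I))
    (v' := fun θ : ℝ => Complex.exp (n * θ * Complex.I) * (n * Complex.I))
    (fun x _ => (hh.differentiable (by simp) x).hasDerivAt)
    (fun x _ => hasDerivAt_exp_mode n x) (hc.intervalIntegrable _ _)
    (((continuous_exp_mode n).mul continuous_const).intervalIntegrable _ _)
  have hi₁ : IntervalIntegrable (fun θ => deriv h θ * Complex.exp (n * θ * Complex.I)) volume 0
      (2 * Real.pi) := (hc.mul (continuous_exp_mode n)).intervalIntegrable _ _
  have hi₂ : IntervalIntegrable (fun θ => h θ * (Complex.exp (n * θ * Complex.I) *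
      (n * Complex.I))) volume 0 (2 * Real.pi) :=
    (hh.continuous.mul ((continuous_exp_mode n).mul continuous_const)).intervalIntegrable _ _
  rw [intervalIntegral.integral_add hi₁ hi₂] at key
  have h0 : h (2 * Real.pi) = h 0 := by simpa using hp 0
  have h1 : Complex.exp (n * (2 * Real.pi : ℝ) * Complex.I) = 1 := by
    rw [Complex.exp_eq_one_iff]
    exact ⟨n, by push_cast; ring⟩
  have h2 : ∫ θ in (0 : ℝ)..2 * Real.pi,
      h θ * (Complex.exp (n * θ * Complex.I) * (n * Complex.I)) =
      (n * Complex.I) * circleCoeff h n := by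
    rw [circleCoeff, ← intervalIntegral.integral_const_mul]
    congr 1
    ext θ
    ring
  rw [h0, h1, h2] at key
  simp only [Complex.ofReal_zero, mul_zero, zero_mul, Complex.exp_zero, sub_self] at key
  rw [circleCoeff]
  linear_combination key

theorem circleCoeff_sub {h k : ℝ → ℂ} (hh : Continuous h) (hk : Continuous k) (n : ℤ) :
    circleCoeff (h - k) n = circleCoeff h n - circleCoeff k n := by
  simp only [circleCoeff, Pi.sub_apply, sub_mul]
  exact intervalIntegral.integral_sub ((hh.mul (continuous_exp_mode n)).intervalIntegrable _ _)
    ((hk.mul (continuous_exp_mode n)).intervalIntegrable _ _)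

theorem exists_norm_circleCoeff_le {h : ℝ → ℂ} (hh : Continuous h) :
    ∃ C, ∀ n, ‖circleCoeff h n‖ ≤ C := by
  obtain ⟨C, hC⟩ := (isCompact_Icc (a := (0 : ℝ)) (b := 2 * Real.pi)).exists_bound_of_continuousOn
    hh.continuousOn
  refine ⟨C * |2 * Real.pi - 0|, fun n => ?_⟩
  refine intervalIntegral.norm_integral_le_of_norm_le_const fun θ hθ => ?_
  rw [uIoc_of_le (by positivity)] at hθ
  have : ‖Complex.exp (n * θ * Complex.I)‖ = 1 := by
    have := Complex.norm_exp_ofReal_mul_I (n * θ)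
    push_cast at this
    exact this
  rw [norm_mul, this, mul_one]
  exact hC θ ⟨hθ.1.le, hθ.2⟩

theorem periodic_deriv {h : ℝ → ℂ} {T : ℝ} (hp : Function.Periodic h T) :
    Function.Periodic (deriv h) T := by
  intro x
  rw [← deriv_comp_add_const, funext hp]

/-- The Fourier coefficients of a smooth periodic function decay rapidly: `(n² + 1)²` is the
symbol of the differential operator `(1 - ∂²)²`. -/
theorem exists_circleCoeff_decay {h : ℝ → ℂ} (hh : ContDiff ℝ ∞ h)
    (hp : Function.Periodic h (2 * Real.pi)) :
    ∃ C, ∀ n : ℤ, ((n : ℝ) ^ 2 + 1) ^ 2 * ‖circleCoeff h n‖ ≤ C := by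
  have smooth : ∀ {k : ℝ → ℂ}, ContDiff ℝ ∞ k → ContDiff ℝ ∞ (deriv k) := fun hk =>
    (contDiff_infty_iff_deriv.1 hk).2
  have step : ∀ {k : ℝ → ℂ}, ContDiff ℝ ∞ k → Function.Periodic k (2 * Real.pi) → ∀ n : ℤ,
      circleCoeff (k - deriv (deriv k)) n = ((n : ℂ) ^ 2 + 1) * circleCoeff k n := by
    intro k hk hkp n
    rw [circleCoeff_sub hk.continuous (smooth (smooth hk)).continuous,
      circleCoeff_deriv (smooth hk) (periodic_deriv hkp), circleCoeff_deriv hk hkp]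
    linear_combination (-(n : ℂ) ^ 2 * circleCoeff k n) * Complex.I_sq
  set h₂ := h - deriv (deriv h) with hh₂
  have s₂ : ContDiff ℝ ∞ h₂ := hh.sub (smooth (smooth hh))
  have p₂ : Function.Periodic h₂ (2 * Real.pi) := by
    intro x
    simp only [hh₂, Pi.sub_apply, hp x, periodic_deriv (periodic_deriv hp) x]
  obtain ⟨C, hC⟩ := exists_norm_circleCoeff_le (h := h₂ - deriv (deriv h₂))
    (s₂.sub (smooth (smooth s₂))).continuous
  refine ⟨C, fun n => ?_⟩
  have := hC n
  rw [step s₂ p₂, step hh hp, ← mul_assoc, ← pow_two, norm_mul, norm_pow] at this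
  have hn : ‖(n : ℂ) ^ 2 + 1‖ = (n : ℝ) ^ 2 + 1 := by
    have : (n : ℂ) ^ 2 + 1 = (((n : ℝ) ^ 2 + 1 : ℝ) : ℂ) := by push_cast; ring
    rw [this, Complex.norm_real, Real.norm_eq_abs, abs_of_nonneg (by positivity)]
  rwa [hn] at this

theorem summable_inv_sq_add_one : Summable fun n : ℤ => ((n : ℝ) ^ 2 + 1)⁻¹ := by
  refine Summable.of_norm_bounded_eventually (Real.summable_one_div_int_pow.2 (one_lt_two)) ?_
  filter_upwards [(Set.finite_singleton (0 : ℤ)).compl_mem_cofinite] with n hn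
  have hn0 : (n : ℝ) ≠ 0 := by simpa using hn
  have : 0 < (n : ℝ) ^ 2 := by positivity
  rw [Real.norm_eq_abs, abs_of_nonneg (by positivity), one_div]
  exact inv_anti₀ this (by linarith)

/-- The pairing of an element of `H^s`, `s ≥ -2`, with a smooth function converges. -/
theorem MemHs.summable_pairing {s : ℝ} (hs : -2 ≤ s) {a : ℤ → ℂ} (ha : MemHs s a) {h : ℝ → ℂ}
    (hh : ContDiff ℝ ∞ h) (hp : Function.Periodic h (2 * Real.pi)) :
    Summable fun n => a n * circleCoeff h n := by
  obtain ⟨C, hC⟩ := exists_circleCoeff_decay hh hp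
  set M := ∑' n : ℤ, ((n : ℝ) ^ 2 + 1) ^ s * ‖a n‖ ^ 2 with hM
  have hbound : ∀ n : ℤ, ‖a n‖ ≤ Real.sqrt M * ((n : ℝ) ^ 2 + 1) := by
    intro n
    have h1 : ((n : ℝ) ^ 2 + 1) ^ s * ‖a n‖ ^ 2 ≤ M :=
      ha.le_tsum n fun j _ => by positivity
    have h2 : ((n : ℝ) ^ 2 + 1) ^ (-2 : ℝ) ≤ ((n : ℝ) ^ 2 + 1) ^ s :=
      Real.rpow_le_rpow_of_exponent_le (by nlinarith [sq_nonneg (n : ℝ)]) hs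
    have h3 : ((n : ℝ) ^ 2 + 1) ^ (-2 : ℝ) * ‖a n‖ ^ 2 ≤ M :=
      (mul_le_mul_of_nonneg_right h2 (by positivity)).trans h1
    rw [Real.rpow_neg (by positivity), Real.rpow_two, inv_mul_le_iff₀ (by positivity)] at h3
    have h4 : ‖a n‖ ≤ Real.sqrt (((n : ℝ) ^ 2 + 1) ^ 2 * M) := Real.le_sqrt_of_sq_le h3
    rwa [Real.sqrt_mul (by positivity), Real.sqrt_sq (by positivity), mul_comm] at h4
  refine Summable.of_norm_bounded (summable_inv_sq_add_one.mul_left (Real.sqrt M * C)) fun n => ?_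
  rw [norm_mul]
  calc ‖a n‖ * ‖circleCoeff h n‖
      ≤ Real.sqrt M * ((n : ℝ) ^ 2 + 1) * ‖circleCoeff h n‖ :=
        mul_le_mul_of_nonneg_right (hbound n) (norm_nonneg _)
    _ = Real.sqrt M * (((n : ℝ) ^ 2 + 1) ^ 2 * ‖circleCoeff h n‖) * ((n : ℝ) ^ 2 + 1)⁻¹ := by
        field_simp
    _ ≤ Real.sqrt M * C * ((n : ℝ) ^ 2 + 1)⁻¹ := by
        gcongr
        exact hC n

theorem memHs_zero (s : ℝ) : MemHs s 0 := by
  simp [MemHs, summable_zero]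

theorem MemHs.add {s : ℝ} {a b : ℤ → ℂ} (ha : MemHs s a) (hb : MemHs s b) : MemHs s (a + b) := by
  refine Summable.of_nonneg_of_le (fun n => by positivity) (fun n => ?_)
    ((Summable.add ha hb).mul_left 2)
  have h1 : ‖a n + b n‖ ^ 2 ≤ 2 * (‖a n‖ ^ 2 + ‖b n‖ ^ 2) := by
    have := pow_le_pow_left₀ (norm_nonneg _) (norm_add_le (a n) (b n)) 2
    nlinarith [sq_nonneg (‖a n‖ - ‖b n‖)]
  calc _ ≤ ((n : ℝ) ^ 2 + 1) ^ s * (2 * (‖a n‖ ^ 2 + ‖b n‖ ^ 2)) :=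
        mul_le_mul_of_nonneg_left h1 (by positivity)
    _ = _ := by ring

theorem MemHs.smul {s : ℝ} {a : ℤ → ℂ} (ha : MemHs s a) (z : ℂ) : MemHs s (z • a) := by
  refine (Summable.mul_left (‖z‖ ^ 2) ha).congr fun n => ?_
  rw [Pi.smul_apply, smul_eq_mul, norm_mul]
  ring

theorem circlePairing_eq (R : ℝ) (a : ℤ → ℂ) (h : ℝ → ℂ) :
    circlePairing R a h = R * ∑' n : ℤ, a n * circleCoeff h n := rfl

@[simp]
theorem circlePairing_zero (R : ℝ) (h : ℝ → ℂ) : circlePairing R 0 h = 0 := by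
  simp [circlePairing]

theorem circlePairing_smul (R : ℝ) (z : ℂ) (a : ℤ → ℂ) (h : ℝ → ℂ) :
    circlePairing R (z • a) h = z * circlePairing R a h := by
  simp only [circlePairing_eq, Pi.smul_apply, smul_eq_mul, mul_assoc, tsum_mul_left]
  ring

theorem circlePairing_add (R : ℝ) {s : ℝ} (hs : -2 ≤ s) {a b : ℤ → ℂ} (ha : MemHs s a)
    (hb : MemHs s b) {h : ℝ → ℂ} (hh : ContDiff ℝ ∞ h)
    (hp : Function.Periodic h (2 * Real.pi)) :
    circlePairing R (a + b) h = circlePairing R a h + circlePairing R b h := by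
  simp only [circlePairing_eq, Pi.add_apply, add_mul]
  rw [(ha.summable_pairing hs hh hp).tsum_add (hb.summable_pairing hs hh hp)]
  ring

theorem contDiff_onCircle (c : ℂ) (R : ℝ) {φ : ℂ → ℂ} (h : φ ∈ TestFun) :
    ContDiff ℝ ∞ (onCircle c R φ) :=
  h.1.comp (contDiff_circleMap c R)

theorem periodic_onCircle (c : ℂ) (R : ℝ) (φ : ℂ → ℂ) :
    Function.Periodic (onCircle c R φ) (2 * Real.pi) := fun θ => by
  simp only [onCircle, periodic_circleMap c R θ]

theorem contDiff_normalOnCircle (c : ℂ) (R : ℝ) {φ : ℂ → ℂ} (h : φ ∈ TestFun) :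
    ContDiff ℝ ∞ (normalOnCircle c R φ) := by
  have h1 : ContDiff ℝ ∞ (fun θ : ℝ => Complex.exp (θ * Complex.I)) := by
    have : ContDiff ℝ ∞ (fun y : ℝ => (y : ℂ)) := Complex.ofRealCLM.contDiff
    fun_prop
  exact ((h.1.fderiv_right (m := ∞) (by simp)).comp (contDiff_circleMap c R)).clm_apply h1

theorem periodic_normalOnCircle (c : ℂ) (R : ℝ) (φ : ℂ → ℂ) :
    Function.Periodic (normalOnCircle c R φ) (2 * Real.pi) := fun θ => by
  have : Complex.exp ((θ + 2 * Real.pi : ℝ) * Complex.I) = Complex.exp (θ * Complex.I) := by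
    push_cast
    rw [add_mul]
    exact Complex.exp_periodic _
  simp only [normalOnCircle, periodic_circleMap c R θ, this]

theorem circleCoeff_exp (m n : ℤ) :
    circleCoeff (fun θ => Complex.exp (-(m * θ * Complex.I))) n =
      if n = m then 2 * (Real.pi : ℂ) else 0 := by
  have h1 : ∀ θ : ℝ, Complex.exp (-(m * θ * Complex.I)) * Complex.exp (n * θ * Complex.I) =
      Complex.exp (((n - m : ℤ) * Complex.I) * θ) := by
    intro θ
    rw [← Complex.exp_add]
    congr 1
    push_cast
    ring
  simp only [circleCoeff, h1]
  split_ifs with hnm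
  · simp [hnm]
  · have h2 : ((n - m : ℤ) * Complex.I : ℂ) ≠ 0 := by
      simp [sub_eq_zero, hnm]
    rw [integral_exp_mul_complex h2]
    have h3 : Complex.exp (((n - m : ℤ) * Complex.I) * (2 * Real.pi : ℝ)) = 1 := by
      rw [Complex.exp_eq_one_iff]
      exact ⟨n - m, by push_cast; ring⟩
    rw [h3]
    simp

/-- Each Fourier mode on `∂B` is the restriction of a test function that vanishes near `K`. -/
theorem exists_testFun_mode {c : ℂ} {R : ℝ} (hR : 0 < R) {K : Set ℂ} (hK : IsClosed K)
    (hKB : K ⊆ ball c R) (m : ℤ) : ∃ φ ∈ TestFun, Disjoint (tsupport φ) K ∧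
      onCircle c R φ = fun θ : ℝ => Complex.exp (-(m * θ * Complex.I)) := by
  obtain ⟨χ, hχ, hχs, hχ1⟩ := exists_cutoff (isCompact_sphere c R) hK.isOpen_compl
    (fun x hx hxK => by
      have h1 := mem_ball.1 (hKB hxK)
      rw [mem_sphere.1 hx] at h1
      exact lt_irrefl _ h1)
  have hRC : (R : ℂ) ≠ 0 := by exact_mod_cast hR.ne'
  have hid : ContDiff ℝ ∞ (fun z : ℂ => (z - c) / R) :=
    (contDiff_id.sub contDiff_const).div_const _
  have hcirc : ∀ θ : ℝ, (circleMap c R θ - c) / R = Complex.exp (θ * Complex.I) := by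
    intro θ
    simp [circleMap, hRC]
  have hon : ∀ θ : ℝ, χ (circleMap c R θ) = 1 := fun θ =>
    hχ1 _ (circleMap_mem_sphere c hR.le θ)
  suffices ∃ f : ℂ → ℂ, ContDiff ℝ ∞ f ∧
      ∀ θ : ℝ, f (circleMap c R θ) = Complex.exp (-(m * θ * Complex.I)) by
    obtain ⟨f, hf, hfθ⟩ := this
    refine ⟨f * χ, mul_mem_testFun hf hχ, ?_, ?_⟩
    · rw [disjoint_left]
      intro x hx
      exact hχs (tsupport_mul_subset_right hx)
    · ext θ
      simp [onCircle, hfθ, hon]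
  obtain ⟨n, rfl | rfl⟩ := m.eq_nat_or_neg
  · refine ⟨fun z => (starRingEnd ℂ ((z - c) / R)) ^ n,
      (Complex.conjCLE.contDiff.comp hid).pow n, fun θ => ?_⟩
    simp only [hcirc]
    rw [← Complex.exp_conj, ← Complex.exp_nat_mul]
    congr 1
    simp
    ring
  · refine ⟨fun z => ((z - c) / R) ^ n, hid.pow n, fun θ => ?_⟩
    simp only [hcirc]
    rw [← Complex.exp_nat_mul]
    congr 1
    push_cast
    ring

/-- The Neumann data on `∂B` are determined by the solution and its Dirichlet data. -/
theorem HasCauchyData.neumann_unique {c : ℂ} {R : ℝ} (hR : 0 < R) {K : Set ℂ} (hK : IsClosed K)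
    (hKB : K ⊆ ball c R) {k2 : ℂ} {v v' : ℂ → ℂ} {f ψ ψ' : ℤ → ℂ}
    (h : HasCauchyData c R K k2 v f ψ) (h' : HasCauchyData c R K k2 v' f ψ')
    (hv : v =ᵐ[volume.restrict (ball c R \ K)] v') : ψ = ψ' := by
  funext m
  obtain ⟨φ, hφ, hφK, hφm⟩ := exists_testFun_mode hR hK hKB m
  have h1 := h.green φ hφ hφK
  have h2 := h'.green φ hφ hφK
  have h3 : ∫ x in ball c R \ K, v x * ((Δ φ) x + k2 * φ x) =
      ∫ x in ball c R \ K, v' x * ((Δ φ) x + k2 * φ x) := by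
    refine integral_congr_ae ?_
    filter_upwards [hv] with x hx
    rw [hx]
  have h4 : circlePairing R ψ (onCircle c R φ) = circlePairing R ψ' (onCircle c R φ) := by
    rw [h3, h2] at h1
    exact (sub_right_injective h1).symm
  have hpair : ∀ a : ℤ → ℂ, circlePairing R a (onCircle c R φ) = R * (a m * (2 * Real.pi)) := by
    intro a
    rw [circlePairing_eq, hφm, tsum_eq_single m]
    · rw [circleCoeff_exp, if_pos rfl]
    · intro n hn
      rw [circleCoeff_exp, if_neg hn, mul_zero]
  rw [hpair, hpair] at h4
  have hRC : (R : ℂ) ≠ 0 := by exact_mod_cast hR.ne'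
  have hpi : (2 * Real.pi : ℂ) ≠ 0 := by
    simp [Real.pi_ne_zero]
  exact mul_right_cancel₀ hpi (mul_left_cancel₀ hRC h4)

/-! ### Test functions vanishing on the boundary of `Ω` -/

theorem countable_simple_zeros {f f' : ℝ → ℂ} (hf : ∀ t, HasDerivAt f (f' t) t) :
    {t | f t = 0 ∧ f' t ≠ 0}.Countable := by
  set S := {t | f t = 0 ∧ f' t ≠ 0} with hS
  refine (countable_setOfPred_isolated_right_within (s := S)).mono fun t ht => (show t ∈ S ∧ _ from ⟨ht, ?_⟩)
  have h1 : ∀ᶠ z in nhdsWithin t {t}ᶜ, f z ≠ 0 := (hf t).eventually_ne ht.2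
  have h2 : nhdsWithin t (S ∩ Ioi t) ≤ nhdsWithin t {t}ᶜ :=
    nhdsWithin_mono _ fun z hz => (ne_of_gt hz.2 : z ≠ t)
  have h3 : ∀ᶠ z in nhdsWithin t (S ∩ Ioi t), False := by
    filter_upwards [h2 h1, self_mem_nhdsWithin] with z hz hzS using hz hzS.1.1
  exact Filter.eventually_false_iff_eq_bot.1 h3

/-- The gradient of a smooth function vanishes almost everywhere on its zero set: on every line,
the zeros at which the derivative along the line does not vanish are isolated. -/
theorem ae_fderiv_eq_zero_of_eq_zero {φ : ℂ → ℂ} (h : φ ∈ TestFun) (e : ℂ) :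
    ∀ᵐ x : ℂ, φ x = 0 → fderiv ℝ φ x e = 0 := by
  have hc : Continuous fun x => fderiv ℝ φ x e := (fderiv_apply_mem_testFun h e).1.continuous
  refine ae_mem_of_ae_add_linearMap_mem (s := {x | φ x = 0 → fderiv ℝ φ x e = 0})
    (LinearMap.toSpanSingleton ℝ ℂ e) volume volume ?_ fun y => ?_
  · have : {x | φ x = 0 → fderiv ℝ φ x e = 0} = {x | φ x = 0}ᶜ ∪ {x | fderiv ℝ φ x e = 0} := by
      ext x; simp [imp_iff_not_or]
    rw [this]
    exact (isClosed_eq h.1.continuous continuous_const).measurableSet.compl.union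
      (isClosed_eq hc continuous_const).measurableSet
  · have hd : ∀ t : ℝ, HasDerivAt (fun t : ℝ => φ (y + t • e)) (fderiv ℝ φ (y + t • e) e) t := by
      intro t
      have h1 : HasDerivAt (fun t : ℝ => y + t • e) e t := by
        simpa using ((hasDerivAt_id t).smul_const e).const_add y
      exact (differentiable_of_mem_testFun h _).hasFDerivAt.comp_hasDerivAt t h1
    have h0 := (countable_simple_zeros hd).ae_notMem (μ := volume)
    filter_upwards [h0] with t ht
    simp only [not_and, not_not] at ht
    simpa using ht

/-- The function `z ↦ z (1 - b(z))`, `b` a smooth bump function: it vanishes on the unit disk, and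
is the identity outside the disk of radius `2`. -/
def trunc : ℂ → ℂ :=
  fun z => (1 - ((⟨1, 2, one_pos, one_lt_two⟩ : ContDiffBump (0 : ℂ)) z : ℂ)) * z

theorem contDiff_trunc : ContDiff ℝ ∞ trunc := by
  have h := (⟨1, 2, one_pos, one_lt_two⟩ : ContDiffBump (0 : ℂ)).contDiff (n := ⊤)
  exact (contDiff_const.sub (Complex.ofRealCLM.contDiff.comp h)).mul contDiff_id

theorem trunc_of_norm_le {z : ℂ} (hz : ‖z‖ ≤ 1) : trunc z = 0 := by
  have : (⟨1, 2, one_pos, one_lt_two⟩ : ContDiffBump (0 : ℂ)) z = 1 :=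
    ContDiffBump.one_of_mem_closedBall _ (by simpa using hz)
  simp [trunc, this]

theorem trunc_of_le_norm {z : ℂ} (hz : 2 ≤ ‖z‖) : trunc z = z := by
  have : (⟨1, 2, one_pos, one_lt_two⟩ : ContDiffBump (0 : ℂ)) z = 0 :=
    ContDiffBump.zero_of_le_dist _ (by simpa using hz)
  simp [trunc, this]

theorem norm_trunc_le (z : ℂ) : ‖trunc z‖ ≤ ‖z‖ := by
  set b : ContDiffBump (0 : ℂ) := ⟨1, 2, one_pos, one_lt_two⟩ with hb
  have h0 : 0 ≤ b z := b.nonneg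
  have h1 : b z ≤ 1 := b.le_one
  have h2 : (1 - (b z : ℂ)) = ((1 - b z : ℝ) : ℂ) := by push_cast; rfl
  rw [trunc, norm_mul, h2, Complex.norm_real, Real.norm_eq_abs, abs_of_nonneg (by linarith)]
  exact mul_le_of_le_one_left (norm_nonneg _) (by linarith)

theorem fderiv_trunc_of_lt {z : ℂ} (hz : 2 < ‖z‖) :
    fderiv ℝ trunc z = ContinuousLinearMap.id ℝ ℂ := by
  have : trunc =ᶠ[nhds z] id := by
    filter_upwards [continuous_norm.continuousAt.eventually (lt_mem_nhds hz)] with y hy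
    exact trunc_of_le_norm (le_of_lt hy)
  rw [this.fderiv_eq, fderiv_id]

theorem exists_norm_fderiv_trunc_le : ∃ C, ∀ z, ‖fderiv ℝ trunc z‖ ≤ C := by
  obtain ⟨C, hC⟩ := (isCompact_closedBall (0 : ℂ) 2).exists_bound_of_continuousOn
    (contDiff_trunc.continuous_fderiv (by simp)).continuousOn
  refine ⟨max C 1, fun z => ?_⟩
  rcases le_or_gt ‖z‖ 2 with hz | hz
  · exact (hC z (by simpa using hz)).trans (le_max_left _ _)
  · rw [fderiv_trunc_of_lt hz]
    exact ContinuousLinearMap.norm_id_le.trans (le_max_right _ _)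

/-- The truncations `G(aφ)/a` of `φ`, `G = trunc`, which tend to `φ` as `a → ∞`. -/
def truncAt (a : ℝ) (φ : ℂ → ℂ) : ℂ → ℂ := fun x => (a : ℂ)⁻¹ * trunc (a * φ x)

theorem contDiff_truncAt (a : ℝ) {φ : ℂ → ℂ} (h : ContDiff ℝ ∞ φ) :
    ContDiff ℝ ∞ (truncAt a φ) :=
  contDiff_const.mul (contDiff_trunc.comp (contDiff_const.mul h))

theorem fderiv_truncAt {a : ℝ} (ha : a ≠ 0) {φ : ℂ → ℂ} (h : Differentiable ℝ φ) (x e : ℂ) :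
    fderiv ℝ (truncAt a φ) x e = fderiv ℝ trunc (a * φ x) (fderiv ℝ φ x e) := by
  have h1 : HasFDerivAt (fun x => (a : ℂ) * φ x) (a • fderiv ℝ φ x) x := by
    have := (h x).hasFDerivAt.const_smul a
    refine this.congr_of_eventuallyEq (Filter.Eventually.of_forall fun y => ?_)
    simp
  have h2 := ((contDiff_trunc.differentiable (by simp) (a * φ x)).hasFDerivAt.comp x h1).const_smul
    a⁻¹
  have h3 : HasFDerivAt (truncAt a φ) _ x :=
    h2.congr_of_eventuallyEq (Filter.Eventually.of_forall fun y => by simp [truncAt])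
  rw [h3.fderiv]
  simp [smul_smul, inv_mul_cancel₀ ha, ← Complex.real_smul]

theorem norm_truncAt_le {a : ℝ} (ha : a ≠ 0) (φ : ℂ → ℂ) (x : ℂ) : ‖truncAt a φ x‖ ≤ ‖φ x‖ := by
  rw [truncAt, norm_mul, norm_inv]
  have hn : 0 < ‖(a : ℂ)‖ := by simpa using ha
  rw [inv_mul_le_iff₀ hn, ← norm_mul]
  exact norm_trunc_le _

/-- For `φ = 0` on `∂Ω`, the truncation of `φ`, restricted to the exterior of `Ω`, is a test
function supported away from `closure Ω`. -/
theorem indicator_truncAt_mem {Ω : Set ℂ} (hΩ : IsOpen Ω) {φ : ℂ → ℂ} (h : φ ∈ TestFun)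
    (h0 : ∀ x ∈ frontier Ω, φ x = 0) (a : ℝ) :
    (closure Ω)ᶜ.indicator (truncAt a φ) ∈ TestFun ∧
      tsupport ((closure Ω)ᶜ.indicator (truncAt a φ)) ⊆ tsupport φ \ closure Ω := by
  classical
  set ψ := (closure Ω)ᶜ.indicator (truncAt a φ) with hψ
  have hnear : ∀ x ∈ closure Ω, ψ =ᶠ[nhds x] 0 := by
    intro x hx
    by_cases hxΩ : x ∈ Ω
    · filter_upwards [hΩ.mem_nhds hxΩ] with y hy
      exact indicator_of_notMem (not_not.2 (subset_closure hy)) _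
    · have hφx : φ x = 0 := h0 x (by rw [hΩ.frontier_eq]; exact ⟨hx, hxΩ⟩)
      have hcont : Continuous fun y => ‖(a : ℂ) * φ y‖ := by
        have := h.1.continuous
        fun_prop
      have hev : ∀ᶠ y in nhds x, ‖(a : ℂ) * φ y‖ < 1 :=
        hcont.continuousAt.eventually (gt_mem_nhds (by simp [hφx]))
      filter_upwards [hev] with y hy
      rw [hψ, indicator_apply]
      split_ifs
      · simp [truncAt, trunc_of_norm_le hy.le]
      · rfl
  have hout : ∀ x ∉ closure Ω, ψ =ᶠ[nhds x] truncAt a φ := by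
    intro x hx
    filter_upwards [isClosed_closure.isOpen_compl.mem_nhds hx] with y hy
    exact indicator_of_mem hy _
  have hsub : tsupport ψ ⊆ tsupport φ := by
    refine closure_mono fun x hx => ?_
    rw [Function.mem_support] at hx ⊢
    intro hφ
    apply hx
    rw [hψ, indicator_apply]
    split_ifs
    · simp [truncAt, hφ, trunc_of_norm_le]
    · rfl
  refine ⟨⟨contDiff_iff_contDiffAt.2 fun x => ?_, ?_⟩, fun x hx => ⟨hsub hx, fun hxc => ?_⟩⟩
  · by_cases hx : x ∈ closure Ω
    · exact contDiffAt_const.congr_of_eventuallyEq (hnear x hx)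
    · exact (contDiff_truncAt a h.1).contDiffAt.congr_of_eventuallyEq (hout x hx)
  · exact h.2.of_isClosed_subset (isClosed_tsupport _) hsub
  · exact (notMem_tsupport_iff_eventuallyEq.2 (hnear x hxc)) hx

/-! ### The weak form of the Helmholtz equation -/

/-- The integrand `∇v·∇φ - k²vφ` of the weak form, `∇v = (p₁, p₂)`. -/
def weakForm (k2 : ℂ) (v p₁ p₂ φ : ℂ → ℂ) (x : ℂ) : ℂ :=
  p₁ x * d₁ φ x + p₂ x * d₂ φ x - k2 * v x * φ x

theorem exists_lt_tsupport_subset_ball {c : ℂ} {R : ℝ} {g : ℂ → ℂ} (hg : tsupport g ⊆ ball c R) :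
    ∃ r < R, tsupport g ⊆ ball c r :=
  exists_lt_subset_ball (isClosed_tsupport g) hg

theorem memLp_mul_testFun {c : ℂ} {R : ℝ} {K : Set ℂ} (hK : IsClosed K) {p g : ℂ → ℂ}
    (hp : ∀ r < R, MemLp p 2 (volume.restrict (ball c r \ K))) (hg : g ∈ TestFun)
    (hgs : tsupport g ⊆ ball c R) : MemLp (p * g) 2 (volume.restrict (ball c R \ K)) := by
  obtain ⟨r, hr, hgr⟩ := exists_lt_tsupport_subset_ball hgs
  obtain ⟨C, hC⟩ := exists_norm_le_of_mem_testFun hg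
  have h1 : MemLp (p * g) 2 (volume.restrict (ball c r \ K)) := by
    have := (memLp_top_of_bound (μ := volume.restrict (ball c r \ K))
      hg.1.continuous.aestronglyMeasurable C (Filter.Eventually.of_forall hC))
    exact this.mul (hp r hr)
  have hm : MeasurableSet (ball c r \ K) := measurableSet_ball.diff hK.measurableSet
  have hm' : MeasurableSet (ball c R \ K) := measurableSet_ball.diff hK.measurableSet
  have h2 : (ball c r \ K).indicator (p * g) = (ball c R \ K).indicator (p * g) := by
    ext x
    by_cases hx : x ∈ ball c r
    · have hx' : x ∈ ball c R := ball_subset_ball hr.le hx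
      by_cases hxK : x ∈ K <;> simp only [indicator, mem_sdiff, hx, hx', hxK]
    · have : g x = 0 := image_eq_zero_of_notMem_tsupport fun h => hx (hgr h)
      simp [indicator, this]
  rw [← memLp_indicator_iff_restrict hm', ← h2, memLp_indicator_iff_restrict hm]
  exact h1

theorem integrable_mul_testFun {c : ℂ} {R : ℝ} {K : Set ℂ} (hK : IsClosed K) {p g : ℂ → ℂ}
    (hp : ∀ r < R, MemLp p 2 (volume.restrict (ball c r \ K))) (hg : g ∈ TestFun)
    (hgs : tsupport g ⊆ ball c R) : Integrable (p * g) (volume.restrict (ball c R \ K)) := by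
  have hm : MeasurableSet (ball c R \ K) := measurableSet_ball.diff hK.measurableSet
  have : IsFiniteMeasure (volume.restrict (ball c R \ K)) :=
    ⟨by rw [Measure.restrict_apply_univ]
        exact (measure_mono sdiff_subset).trans_lt measure_ball_lt_top⟩
  exact (memLp_mul_testFun hK hp hg hgs).integrable (by norm_num)

section

variable {c : ℂ} {R : ℝ} {K : Set ℂ} {k2 : ℂ} {v p₁ p₂ : ℂ → ℂ}

theorem InSolutionSpace.memLp_ball (h : InSolutionSpace c R K v p₁ p₂) :
    ∀ r < R, MemLp v 2 (volume.restrict (ball c r \ K)) := fun _ hr =>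
  h.memLp.mono_measure (Measure.restrict_mono (sdiff_subset_sdiff_left (ball_subset_ball hr.le))
    le_rfl)

theorem integrable_weakForm (hK : IsClosed K) (h : InSolutionSpace c R K v p₁ p₂) {φ : ℂ → ℂ}
    (hφ : φ ∈ TestFun) (hs : tsupport φ ⊆ ball c R) :
    Integrable (weakForm k2 v p₁ p₂ φ) (volume.restrict (ball c R \ K)) := by
  have h1 := integrable_mul_testFun hK h.memLp₁ (d₁_mem_testFun hφ)
    ((tsupport_d₁_subset φ).trans hs)
  have h2 := integrable_mul_testFun hK h.memLp₂ (d₂_mem_testFun hφ)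
    ((tsupport_d₂_subset φ).trans hs)
  have h3 := (integrable_mul_testFun hK h.memLp_ball hφ hs).const_mul k2
  refine ((h1.add h2).sub h3).congr (Filter.Eventually.of_forall fun x => ?_)
  simp [weakForm, mul_assoc]

theorem integral_weakForm_sub (hK : IsClosed K) (h : InSolutionSpace c R K v p₁ p₂)
    {φ ψ : ℂ → ℂ} (hφ : φ ∈ TestFun) (hφs : tsupport φ ⊆ ball c R) (hψ : ψ ∈ TestFun)
    (hψs : tsupport ψ ⊆ ball c R) :
    ∫ x in ball c R \ K, weakForm k2 v p₁ p₂ (φ - ψ) x =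
      (∫ x in ball c R \ K, weakForm k2 v p₁ p₂ φ x) -
        ∫ x in ball c R \ K, weakForm k2 v p₁ p₂ ψ x := by
  rw [← integral_sub (integrable_weakForm hK h hφ hφs) (integrable_weakForm hK h hψ hψs)]
  refine integral_congr_ae (Filter.Eventually.of_forall fun x => ?_)
  have e1 : d₁ (φ - ψ) x = d₁ φ x - d₁ ψ x := by
    simp [d₁, fderiv_sub (differentiable_of_mem_testFun hφ x) (differentiable_of_mem_testFun hψ x)]
  have e2 : d₂ (φ - ψ) x = d₂ φ x - d₂ ψ x := by
    simp [d₂, fderiv_sub (differentiable_of_mem_testFun hφ x) (differentiable_of_mem_testFun hψ x)]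
  simp only [weakForm, e1, e2, Pi.sub_apply]
  ring

/-- A weak solution in `B ∖ closure Ω` may be tested with functions that merely vanish on `∂Ω`:
such a function is a limit of its truncations, which are supported in `B ∖ closure Ω`. -/
theorem integral_weakForm_eq_zero {Ω : Set ℂ} (hΩ : IsOpen Ω)
    (h : InSolutionSpace c R (closure Ω) v p₁ p₂)
    (hw : ∀ φ ∈ TestFun, tsupport φ ⊆ ball c R \ closure Ω →
      ∫ x in ball c R \ closure Ω, weakForm k2 v p₁ p₂ φ x = 0)
    {φ : ℂ → ℂ} (hφ : φ ∈ TestFun) (hs : tsupport φ ⊆ ball c R)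
    (h0 : ∀ x ∈ frontier Ω, φ x = 0) :
    ∫ x in ball c R \ closure Ω, weakForm k2 v p₁ p₂ φ x = 0 := by
  set U := ball c R \ closure Ω with hU
  have hUo : IsOpen U := isOpen_ball.sdiff isClosed_closure
  obtain ⟨C, hC⟩ := exists_norm_fderiv_trunc_le
  let ψ : ℕ → ℂ → ℂ := fun n => (closure Ω)ᶜ.indicator (truncAt (n + 1) φ)
  have hψ : ∀ n, ψ n ∈ TestFun ∧ tsupport (ψ n) ⊆ tsupport φ \ closure Ω := fun n =>
    indicator_truncAt_mem hΩ hφ h0 _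
  have hpos : ∀ n : ℕ, (n + 1 : ℝ) ≠ 0 := fun n => by positivity
  have hψU : ∀ n, ∀ x ∈ U, ψ n x = truncAt (n + 1) φ x := fun n x hx =>
    indicator_of_mem (show x ∈ (closure Ω)ᶜ from hx.2) _
  have hψd : ∀ n, ∀ x ∈ U, ∀ e, fderiv ℝ (ψ n) x e =
      fderiv ℝ trunc ((n + 1 : ℝ) * φ x) (fderiv ℝ φ x e) := by
    intro n x hx e
    have : ψ n =ᶠ[nhds x] truncAt (n + 1) φ := by
      filter_upwards [hUo.mem_nhds hx] with y hy using hψU n y hy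
    rw [this.fderiv_eq, fderiv_truncAt (hpos n) (differentiable_of_mem_testFun hφ)]
  have hlim : Filter.Tendsto (fun n => ∫ x in U, weakForm k2 v p₁ p₂ (ψ n) x) Filter.atTop
      (nhds (∫ x in U, weakForm k2 v p₁ p₂ φ x)) := by
    have i1 := integrable_mul_testFun isClosed_closure h.memLp₁ (d₁_mem_testFun hφ)
      ((tsupport_d₁_subset φ).trans hs)
    have i2 := integrable_mul_testFun isClosed_closure h.memLp₂ (d₂_mem_testFun hφ)
      ((tsupport_d₂_subset φ).trans hs)
    have i3 := (integrable_mul_testFun isClosed_closure h.memLp_ball hφ hs).const_mul k2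
    refine tendsto_integral_of_dominated_convergence
      (fun x => C * ‖(p₁ * d₁ φ) x‖ + C * ‖(p₂ * d₂ φ) x‖ + ‖k2 * (v * φ) x‖)
      (fun n => (integrable_weakForm isClosed_closure h (hψ n).1
        (((hψ n).2.trans sdiff_subset).trans hs)).1)
      (((i1.norm.const_mul C).add (i2.norm.const_mul C)).add i3.norm) (fun n => ?_) ?_
    · filter_upwards [ae_restrict_mem hUo.measurableSet] with x hx
      rw [weakForm, d₁, d₂, hψd n x hx, hψd n x hx, hψU n x hx]
      have hop : ∀ e, ‖fderiv ℝ trunc ((n + 1 : ℝ) * φ x) (fderiv ℝ φ x e)‖ ≤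
          C * ‖fderiv ℝ φ x e‖ := fun e =>
        ContinuousLinearMap.le_of_opNorm_le _ (hC _) _
      refine (norm_sub_le _ _).trans (add_le_add ((norm_add_le _ _).trans (add_le_add ?_ ?_)) ?_)
      · rw [norm_mul, Pi.mul_apply, norm_mul, mul_left_comm]
        exact mul_le_mul_of_nonneg_left (hop 1) (norm_nonneg _)
      · rw [norm_mul, Pi.mul_apply, norm_mul, mul_left_comm]
        exact mul_le_mul_of_nonneg_left (hop Complex.I) (norm_nonneg _)
      · rw [norm_mul, norm_mul, norm_mul, Pi.mul_apply, norm_mul, mul_assoc]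
        gcongr
        exact norm_truncAt_le (hpos n) φ x
    · filter_upwards [ae_restrict_mem hUo.measurableSet,
        ae_restrict_of_ae (ae_fderiv_eq_zero_of_eq_zero hφ 1),
        ae_restrict_of_ae (ae_fderiv_eq_zero_of_eq_zero hφ Complex.I)] with x hx hx1 hx2
      refine tendsto_const_nhds.congr' ?_
      by_cases hφx : φ x = 0
      · refine Filter.Eventually.of_forall fun n => ?_
        simp only [weakForm, d₁, d₂]
        rw [hψd n x hx, hψd n x hx, hψU n x hx, hx1 hφx,
          hx2 hφx, truncAt, hφx]
        simp [trunc_of_norm_le]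
      · have hn : 0 < ‖φ x‖ := norm_pos_iff.2 hφx
        obtain ⟨N, hN⟩ := exists_nat_gt (2 / ‖φ x‖)
        filter_upwards [Filter.eventually_ge_atTop N] with n hnN
        have hbig : 2 < ‖((n + 1 : ℝ) : ℂ) * φ x‖ := by
          rw [norm_mul, Complex.norm_real, Real.norm_eq_abs, abs_of_pos (by positivity)]
          rw [div_lt_iff₀ hn] at hN
          have : (N : ℝ) ≤ n + 1 := by
            have : (N : ℝ) ≤ n := by exact_mod_cast hnN
            linarith
          nlinarith
        have hne : ((n + 1 : ℝ) : ℂ) ≠ 0 := by exact_mod_cast hpos n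
        simp only [weakForm, d₁, d₂]
        rw [hψd n x hx, hψd n x hx, hψU n x hx,
          fderiv_trunc_of_lt hbig, truncAt, trunc_of_le_norm hbig.le, inv_mul_cancel_left₀ hne]
        rfl
  refine tendsto_nhds_unique hlim ?_
  have : (fun n => ∫ x in U, weakForm k2 v p₁ p₂ (ψ n) x) = fun _ => 0 := by
    ext n
    refine hw _ (hψ n).1 ((hψ n).2.trans (sdiff_subset_sdiff_left hs))
  rw [this]
  exact tendsto_const_nhds

end

/-! ### Traces on `∂Ω` of functions that are `H¹` near `∂Ω` -/

section

variable {c : ℂ} {R : ℝ} {K : Set ℂ} {v p₁ p₂ : ℂ → ℂ}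

theorem memLp_mul_testFun_univ (hK : IsClosed K) {p g : ℂ → ℂ}
    (hp : ∀ r < R, MemLp p 2 (volume.restrict (ball c r \ K))) (hg : g ∈ TestFun)
    (hgs : tsupport g ⊆ ball c R \ K) : MemLp (p * g) 2 volume := by
  have hm : MeasurableSet (ball c R \ K) := measurableSet_ball.diff hK.measurableSet
  have h := memLp_mul_testFun hK hp hg (hgs.trans sdiff_subset)
  have hind : (ball c R \ K).indicator (p * g) = p * g :=
    indicator_eq_self.2 fun x hx => hgs (subset_tsupport g (right_ne_zero_of_mul hx))
  rwa [← memLp_indicator_iff_restrict hm, hind] at h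

theorem InSolutionSpace.integral_mul_fderiv (h : InSolutionSpace c R K v p₁ p₂) (hK : IsClosed K)
    {χ : ℂ → ℂ} (hχ : χ ∈ TestFun) (hχs : tsupport χ ⊆ ball c R \ K) {e : ℂ} {p : ℂ → ℂ}
    (hp : ∀ r < R, MemLp p 2 (volume.restrict (ball c r \ K)))
    (hw : ∀ φ ∈ TestFun, tsupport φ ⊆ ball c R \ K →
      ∫ x in ball c R \ K, v x * fderiv ℝ φ x e = -∫ x in ball c R \ K, p x * φ x)
    {φ : ℂ → ℂ} (hφ : φ ∈ TestFun) :
    ∫ x, (v * χ) x * fderiv ℝ φ x e =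
      -∫ x, (p * χ + v * fun x => fderiv ℝ χ x e) x * φ x := by
  have hχB := hχs.trans sdiff_subset
  have hχe := fderiv_apply_mem_testFun hχ e
  have hφe := fderiv_apply_mem_testFun hφ e
  have hχes : tsupport (fun x => fderiv ℝ χ x e) ⊆ tsupport χ := tsupport_fderiv_apply_subset ℝ e
  have hχφ : χ * φ ∈ TestFun := mul_mem_testFun hχ.1 hφ
  have hs : tsupport (χ * φ) ⊆ tsupport χ := tsupport_mul_subset_left
  have hχ0 : ∀ x ∉ ball c R \ K, χ x = 0 := fun x hx =>
    image_eq_zero_of_notMem_tsupport fun hx' => hx (hχs hx')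
  have hχ1 : ∀ x ∉ ball c R \ K, fderiv ℝ χ x e = 0 := fun x hx =>
    image_eq_zero_of_notMem_tsupport (f := fun x => fderiv ℝ χ x e)
      fun hx' => hx (hχs (hχes hx'))
  have key := hw (χ * φ) hχφ (hs.trans hχs)
  have hi : ∀ g ∈ TestFun, tsupport g ⊆ tsupport χ → ∀ p : ℂ → ℂ,
      (∀ r < R, MemLp p 2 (volume.restrict (ball c r \ K))) →
      Integrable (fun x => p x * g x) (volume.restrict (ball c R \ K)) := fun g hg hgs p hp =>
    integrable_mul_testFun hK hp hg (hgs.trans hχB)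
  have i1 := hi _ (mul_mem_testFun hχ.1 hφe) tsupport_mul_subset_left v h.memLp_ball
  have i2 := hi _ (mul_mem_testFun hχe.1 hφ) (tsupport_mul_subset_left.trans hχes) v h.memLp_ball
  have i3 := hi _ hχφ hs p hp
  rw [← setIntegral_eq_integral_of_forall_compl_eq_zero (s := ball c R \ K)
      (f := fun x => (v * χ) x * fderiv ℝ φ x e) (fun x hx => by simp [hχ0 x hx]),
    ← setIntegral_eq_integral_of_forall_compl_eq_zero (s := ball c R \ K)
      (f := fun x => (p * χ + v * fun x => fderiv ℝ χ x e) x * φ x)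
      (fun x hx => by simp [hχ0 x hx, hχ1 x hx])]
  have e1 : ∀ x, v x * fderiv ℝ (χ * φ) x e = v x * (χ * fun x => fderiv ℝ φ x e) x +
      v x * ((fun x => fderiv ℝ χ x e) * φ) x := by
    intro x
    rw [← mul_add]
    exact congrArg (v x * ·) (congrFun (fderiv_mul_apply (differentiable_of_mem_testFun hχ)
      (differentiable_of_mem_testFun hφ) e) x)
  have e2 : ∀ x, (p * χ + v * fun x => fderiv ℝ χ x e) x * φ x =
      p x * (χ * φ) x + v x * ((fun x => fderiv ℝ χ x e) * φ) x := by
    intro x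
    simp only [Pi.add_apply, Pi.mul_apply]
    ring
  have e3 : ∀ x, (v * χ) x * fderiv ℝ φ x e = v x * (χ * fun x => fderiv ℝ φ x e) x := by
    intro x
    simp only [Pi.mul_apply, mul_assoc]
  simp only [e1] at key
  rw [integral_add i1 i2] at key
  simp only [e2, e3]
  rw [integral_add i3 i2]
  linear_combination key

/-- The product of a function in the solution space with a cutoff function that vanishes near `K`
is in `H¹(ℝ²)`. -/
theorem InSolutionSpace.hasWeakGradient_mul (h : InSolutionSpace c R K v p₁ p₂) (hK : IsClosed K)
    {χ : ℂ → ℂ} (hχ : χ ∈ TestFun) (hχs : tsupport χ ⊆ ball c R \ K) :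
    HasWeakGradient univ (v * χ) (p₁ * χ + v * d₁ χ) (p₂ * χ + v * d₂ χ) := by
  intro φ hφ _
  simp only [setIntegral_univ]
  exact ⟨h.integral_mul_fderiv hK hχ hχs h.memLp₁ (fun φ hφ hs => (h.weakGradient φ hφ hs).1) hφ,
    h.integral_mul_fderiv hK hχ hχs h.memLp₂ (fun φ hφ hs => (h.weakGradient φ hφ hs).2) hφ⟩

theorem InSolutionSpace.exists_testFun_sobNorm_le (h : InSolutionSpace c R K v p₁ p₂)
    (hK : IsClosed K) {χ : ℂ → ℂ} (hχ : χ ∈ TestFun) (hχs : tsupport χ ⊆ ball c R \ K)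
    {ε : ℝ≥0∞} (hε : ε ≠ 0) : ∃ φ ∈ TestFun,
      sobNorm (v * χ - φ) (p₁ * χ + v * d₁ χ - d₁ φ) (p₂ * χ + v * d₂ χ - d₂ φ) ≤ ε := by
  refine exists_testFun_sobNorm_sub_le (memLp_mul_testFun_univ hK h.memLp_ball hχ hχs)
    ((memLp_mul_testFun_univ hK h.memLp₁ hχ hχs).add (memLp_mul_testFun_univ hK h.memLp_ball
      (d₁_mem_testFun hχ) ((tsupport_d₁_subset χ).trans hχs)))
    ((memLp_mul_testFun_univ hK h.memLp₂ hχ hχs).add (memLp_mul_testFun_univ hK h.memLp_ball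
      (d₂_mem_testFun hχ) ((tsupport_d₂_subset χ).trans hχs)))
    hχ.2.mul_left (h.hasWeakGradient_mul hK hχ hχs) hε

theorem eLpNorm_mul_le_of_bound {θ f : ℂ → ℂ} {M : ℝ} (hM : ∀ x, ‖θ x‖ ≤ M) :
    eLpNorm (θ * f) 2 volume ≤ ENNReal.ofReal M * eLpNorm f 2 volume := by
  refine eLpNorm_le_mul_eLpNorm_of_ae_le_mul (Filter.Eventually.of_forall fun x => ?_) 2
  rw [Pi.mul_apply, norm_mul]
  exact mul_le_mul_of_nonneg_right (hM x) (norm_nonneg _)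

theorem eLpNorm_mul_sub_le {θ w w' f g : ℂ → ℂ} {M : ℝ} (hM : ∀ x, ‖θ x‖ ≤ M)
    (hθ : Continuous θ) (hw : AEStronglyMeasurable w volume)
    (hw' : AEStronglyMeasurable w' volume) (hf : Continuous f) (hg : Continuous g)
    (heq : θ * w = θ * w') :
    eLpNorm (θ * (f - g)) 2 volume ≤
      ENNReal.ofReal M * (eLpNorm (w - f) 2 volume + eLpNorm (w' - g) 2 volume) := by
  have : θ * (f - g) = θ * (w' - g) - θ * (w - f) := by
    rw [mul_sub, mul_sub, mul_sub, ← heq]; ring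
  rw [this, mul_add, add_comm]
  refine (eLpNorm_sub_le (hθ.aestronglyMeasurable.mul (hw'.sub hg.aestronglyMeasurable))
    (hθ.aestronglyMeasurable.mul (hw.sub hf.aestronglyMeasurable)) (by norm_num)).trans ?_
  exact add_le_add (eLpNorm_mul_le_of_bound hM) (eLpNorm_mul_le_of_bound hM)

/-- The trace is local: if `v₁` and `v₂` coincide, together with their gradients, on the support of
a function `θ` with `θ = 1` on `∂Ω`, then test functions close to `v₁` and `v₂` in `H¹(ℝ²)` have
traces on `∂Ω` that are close to each other. -/
theorem IsLipschitzDomain.exists_trace_sub_le {Ω : Set ℂ} (hΩ : IsLipschitzDomain Ω) {θ : ℂ → ℂ}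
    (hθ : θ ∈ TestFun) (hθ1 : ∀ x ∈ frontier Ω, θ x = 1) :
    ∃ C : ℝ≥0∞, C ≠ ⊤ ∧ ∀ w P Q w' P' Q' φ φ' : ℂ → ℂ,
      AEStronglyMeasurable w volume → AEStronglyMeasurable P volume →
      AEStronglyMeasurable Q volume → AEStronglyMeasurable w' volume →
      AEStronglyMeasurable P' volume → AEStronglyMeasurable Q' volume →
      θ * w = θ * w' → d₁ θ * w = d₁ θ * w' → d₂ θ * w = d₂ θ * w' →
      θ * P = θ * P' → θ * Q = θ * Q' → φ ∈ TestFun → φ' ∈ TestFun →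
      eLpNorm (φ - φ') 2 (bdry Ω) ≤ C * (sobNorm (w - φ) (P - d₁ φ) (Q - d₂ φ) +
        sobNorm (w' - φ') (P' - d₁ φ') (Q' - d₂ φ')) := by
  obtain ⟨C, hC, h⟩ := hΩ.exists_trace_le
  obtain ⟨M₀, hM₀⟩ := exists_norm_le_of_mem_testFun hθ
  obtain ⟨M₁, hM₁⟩ := exists_norm_le_of_mem_testFun (d₁_mem_testFun hθ)
  obtain ⟨M₂, hM₂⟩ := exists_norm_le_of_mem_testFun (d₂_mem_testFun hθ)
  set N := ENNReal.ofReal M₀ + ENNReal.ofReal M₁ + ENNReal.ofReal M₂ with hN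
  refine ⟨C * N, ENNReal.mul_ne_top hC (by simp [hN]), ?_⟩
  intro w P Q w' P' Q' φ φ' mw mP mQ mw' mP' mQ' e0 e1 e2 eP eQ hφ hφ'
  have hsub : φ - φ' ∈ TestFun := TestFun.sub_mem hφ hφ'
  have hprod : θ * (φ - φ') ∈ TestFun := mul_mem_testFun hθ.1 hsub
  have hdθ := differentiable_of_mem_testFun hθ
  have hdφ := differentiable_of_mem_testFun hφ
  have hdφ' := differentiable_of_mem_testFun hφ'
  have hd₁ : d₁ (φ - φ') = d₁ φ - d₁ φ' := by
    ext x; simp [d₁, fderiv_sub (hdφ x) (hdφ' x)]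
  have hd₂ : d₂ (φ - φ') = d₂ φ - d₂ φ' := by
    ext x; simp [d₂, fderiv_sub (hdφ x) (hdφ' x)]
  have htr : eLpNorm (φ - φ') 2 (bdry Ω) = eLpNorm (θ * (φ - φ')) 2 (bdry Ω) := by
    refine eLpNorm_congr_ae ?_
    filter_upwards [ae_restrict_mem isClosed_frontier.measurableSet] with x hx
    simp [hθ1 x hx]
  rw [htr, mul_assoc]
  refine (h _ hprod).trans (mul_le_mul_right ?_ C)
  rw [sobNorm, d₁_mul hdθ (differentiable_of_mem_testFun hsub),
    d₂_mul hdθ (differentiable_of_mem_testFun hsub), hd₁, hd₂]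
  have cθ := hθ.1.continuous
  have cθ₁ := (d₁_mem_testFun hθ).1.continuous
  have cθ₂ := (d₂_mem_testFun hθ).1.continuous
  have cφ := hφ.1.continuous
  have cφ' := hφ'.1.continuous
  have cφ₁ := (d₁_mem_testFun hφ).1.continuous
  have cφ₁' := (d₁_mem_testFun hφ').1.continuous
  have cφ₂ := (d₂_mem_testFun hφ).1.continuous
  have cφ₂' := (d₂_mem_testFun hφ').1.continuous
  have t0 := eLpNorm_mul_sub_le hM₀ cθ mw mw' cφ cφ' e0
  have t1 := eLpNorm_mul_sub_le hM₁ cθ₁ mw mw' cφ cφ' e1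
  have t2 := eLpNorm_mul_sub_le hM₂ cθ₂ mw mw' cφ cφ' e2
  have tP := eLpNorm_mul_sub_le hM₀ cθ mP mP' cφ₁ cφ₁' eP
  have tQ := eLpNorm_mul_sub_le hM₀ cθ mQ mQ' cφ₂ cφ₂' eQ
  have s1 : eLpNorm (θ * (d₁ φ - d₁ φ') + d₁ θ * (φ - φ')) 2 volume ≤ _ :=
    (eLpNorm_add_le (cθ.mul (cφ₁.sub cφ₁')).aestronglyMeasurable
      (cθ₁.mul (cφ.sub cφ')).aestronglyMeasurable (by norm_num)).trans (add_le_add tP t1)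
  have s2 : eLpNorm (θ * (d₂ φ - d₂ φ') + d₂ θ * (φ - φ')) 2 volume ≤ _ :=
    (eLpNorm_add_le (cθ.mul (cφ₂.sub cφ₂')).aestronglyMeasurable
      (cθ₂.mul (cφ.sub cφ')).aestronglyMeasurable (by norm_num)).trans (add_le_add tQ t2)
  refine (add_le_add (add_le_add t0 s1) s2).trans ?_
  simp only [sobNorm, hN]
  generalize eLpNorm (w - φ) 2 volume = a0
  generalize eLpNorm (P - d₁ φ) 2 volume = a1
  generalize eLpNorm (Q - d₂ φ) 2 volume = a2
  generalize eLpNorm (w' - φ') 2 volume = b0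
  generalize eLpNorm (P' - d₁ φ') 2 volume = b1
  generalize eLpNorm (Q' - d₂ φ') 2 volume = b2
  generalize ENNReal.ofReal M₀ = m0
  generalize ENNReal.ofReal M₁ = m1
  generalize ENNReal.ofReal M₂ = m2
  calc _ ≤ m0 * (a0 + b0) + (m0 * (a1 + b1) + m1 * (a0 + b0)) + (m0 * (a2 + b2) + m2 * (a0 + b0))
        + (m1 + m2) * (a1 + b1 + a2 + b2) := le_self_add
    _ = _ := by ring

theorem exists_mul_le {C δ : ℝ≥0∞} (hC : C ≠ ⊤) (hδ : δ ≠ 0) : ∃ ε : ℝ≥0∞, ε ≠ 0 ∧ C * ε < δ := by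
  obtain ⟨n, hn, h⟩ := ENNReal.exists_nnreal_pos_mul_lt hC hδ
  exact ⟨n, by simpa using hn.ne', by rwa [mul_comm]⟩

/-- A function in the solution space of `B ∖ K` has a trace on `∂Ω`, if `K ⊆ Ω`. -/
theorem InSolutionSpace.exists_isTrace (h : InSolutionSpace c R K v p₁ p₂) (hK : IsClosed K)
    {Ω : Set ℂ} (hΩ : IsLipschitzDomain Ω) (hKΩ : K ⊆ Ω) (hΩB : closure Ω ⊆ ball c R) :
    ∃ t, IsTrace c R Ω v p₁ p₂ t := by
  have := hΩ.isFiniteMeasure_bdry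
  have hUo : IsOpen (ball c R \ K) := isOpen_ball.sdiff hK
  have hfr : frontier Ω ⊆ ball c R \ K := fun x hx =>
    ⟨hΩB (frontier_subset_closure hx), fun hxK => by
      rw [hΩ.isOpen.frontier_eq] at hx
      exact hx.2 (hKΩ hxK)⟩
  obtain ⟨θ, hθ, hθs, hθ1⟩ := exists_cutoff hΩ.isCompact_frontier hUo hfr
  -- A cutoff `χ` for each radius `r`: being `1` on `closedBall c r \ Ω`, it does not change `v`
  -- there; being `1` on the support of `θ`, it makes the trace of `v χ` independent of `r`.
  have hcut : ∀ r < R, ∃ χ ∈ TestFun, tsupport χ ⊆ ball c R \ K ∧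
      ∀ x ∈ (closedBall c r \ Ω) ∪ tsupport θ, χ x = 1 := by
    intro r hr
    refine exists_cutoff ?_ hUo (union_subset ?_ hθs)
    · exact (((isCompact_closedBall c r).diff hΩ.isOpen)).union hθ.2.isCompact
    · exact fun x hx => ⟨closedBall_subset_ball hr hx.1, fun hxK => hx.2 (hKΩ hxK)⟩
  obtain ⟨C, hC, hclose⟩ := hΩ.exists_trace_sub_le hθ hθ1
  -- The products `v χ` for two such cutoffs coincide near `∂Ω`.
  have hcmp : ∀ χ ∈ TestFun, tsupport χ ⊆ ball c R \ K → (∀ x ∈ tsupport θ, χ x = 1) →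
      ∀ χ' ∈ TestFun, tsupport χ' ⊆ ball c R \ K → (∀ x ∈ tsupport θ, χ' x = 1) →
      ∀ φ ∈ TestFun, ∀ φ' ∈ TestFun, eLpNorm (φ - φ') 2 (bdry Ω) ≤
        C * (sobNorm (v * χ - φ) (p₁ * χ + v * d₁ χ - d₁ φ) (p₂ * χ + v * d₂ χ - d₂ φ) +
          sobNorm (v * χ' - φ') (p₁ * χ' + v * d₁ χ' - d₁ φ')
            (p₂ * χ' + v * d₂ χ' - d₂ φ')) := by
    intro χ hχ hχs hχ1 χ' hχ' hχs' hχ1' φ hφ φ' hφ'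
    have m : ∀ {p g : ℂ → ℂ}, (∀ r < R, MemLp p 2 (volume.restrict (ball c r \ K))) →
        g ∈ TestFun → tsupport g ⊆ ball c R \ K → AEStronglyMeasurable (p * g) volume :=
      fun hp hg hgs => (memLp_mul_testFun_univ hK hp hg hgs).1
    have s₁ := (tsupport_d₁_subset χ).trans hχs
    have s₂ := (tsupport_d₂_subset χ).trans hχs
    have s₁' := (tsupport_d₁_subset χ').trans hχs'
    have s₂' := (tsupport_d₂_subset χ').trans hχs'
    have hloc : ∀ g : ℂ → ℂ, tsupport g ⊆ tsupport θ → g * (v * χ) = g * (v * χ') := by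
      intro g hg
      ext x
      by_cases hx : x ∈ tsupport θ
      · simp [hχ1 x hx, hχ1' x hx]
      · have : g x = 0 := image_eq_zero_of_notMem_tsupport fun hx' => hx (hg hx')
        simp [this]
    have hopen : IsOpen (Function.support θ) := hθ.1.continuous.isOpen_support
    have hsup : ∀ x ∈ Function.support θ, χ x = 1 := fun x hx => hχ1 x (subset_tsupport θ hx)
    have hsup' : ∀ x ∈ Function.support θ, χ' x = 1 := fun x hx => hχ1' x (subset_tsupport θ hx)
    refine hclose _ _ _ _ _ _ φ φ' (m h.memLp_ball hχ hχs)
      ((m h.memLp₁ hχ hχs).add (m h.memLp_ball (d₁_mem_testFun hχ) s₁))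
      ((m h.memLp₂ hχ hχs).add (m h.memLp_ball (d₂_mem_testFun hχ) s₂))
      (m h.memLp_ball hχ' hχs')
      ((m h.memLp₁ hχ' hχs').add (m h.memLp_ball (d₁_mem_testFun hχ') s₁'))
      ((m h.memLp₂ hχ' hχs').add (m h.memLp_ball (d₂_mem_testFun hχ') s₂'))
      (hloc θ subset_rfl) (hloc _ (tsupport_d₁_subset θ)) (hloc _ (tsupport_d₂_subset θ))
      ?_ ?_ hφ hφ'
    · ext x
      by_cases hx : x ∈ Function.support θ
      · simp [hsup x hx, hsup' x hx, d₁_eq_zero_of_eqOn hopen hsup hx,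
          d₁_eq_zero_of_eqOn hopen hsup' hx]
      · simp [Function.notMem_support.1 hx]
    · ext x
      by_cases hx : x ∈ Function.support θ
      · simp [hsup x hx, hsup' x hx, d₂_eq_zero_of_eqOn hopen hsup hx,
          d₂_eq_zero_of_eqOn hopen hsup' hx]
      · simp [Function.notMem_support.1 hx]
  obtain ⟨χ₀, hχ₀, hχ₀s, hχ₀1⟩ := hcut (R - 1) (by linarith)
  have hχ₀1' : ∀ x ∈ tsupport θ, χ₀ x = 1 := fun x hx => hχ₀1 x (Or.inr hx)
  have hseq : ∀ n : ℕ, ∃ φ ∈ TestFun, (C + 1) *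
      sobNorm (v * χ₀ - φ) (p₁ * χ₀ + v * d₁ χ₀ - d₁ φ) (p₂ * χ₀ + v * d₂ χ₀ - d₂ φ) <
        2⁻¹ ^ n / 2 := by
    intro n
    obtain ⟨ε, hε, hCε⟩ := exists_mul_le (C := C + 1) (δ := 2⁻¹ ^ n / 2)
      (ENNReal.add_ne_top.2 ⟨hC, ENNReal.one_ne_top⟩)
      (by simp [ENNReal.div_eq_zero_iff])
    obtain ⟨φ, hφ, hφε⟩ := h.exists_testFun_sobNorm_le hK hχ₀ hχ₀s hε
    exact ⟨φ, hφ, (mul_le_mul_right hφε _).trans_lt hCε⟩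
  choose φ hφ hφs using hseq
  have hφs' : ∀ n, C * sobNorm (v * χ₀ - φ n) (p₁ * χ₀ + v * d₁ χ₀ - d₁ (φ n))
      (p₂ * χ₀ + v * d₂ χ₀ - d₂ (φ n)) < 2⁻¹ ^ n / 2 := fun n =>
    (mul_le_mul_left le_self_add _).trans_lt (hφs n)
  obtain ⟨t, ht, hlim⟩ := Lp.cauchy_complete_eLpNorm (p := 2) (μ := bdry Ω) (f := φ)
    (B := fun n => 2⁻¹ ^ n) (by norm_num) (fun n => memLp_of_mem_testFun (hφ n) 2 _)
    (by simp [ENNReal.tsum_geometric]) (fun N n m hn hm => by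
      refine (hcmp χ₀ hχ₀ hχ₀s hχ₀1' χ₀ hχ₀ hχ₀s hχ₀1' _ (hφ n) _ (hφ m)).trans_lt ?_
      rw [mul_add, ← ENNReal.add_halves (2⁻¹ ^ N)]
      have hmono : ∀ k, N ≤ k → (2⁻¹ : ℝ≥0∞) ^ k / 2 ≤ 2⁻¹ ^ N / 2 := fun k hk =>
        ENNReal.div_le_div_right (pow_le_pow_right_of_le_one' (by simp) hk) 2
      exact ENNReal.add_lt_add ((hφs' n).trans_le (hmono n hn)) ((hφs' m).trans_le (hmono m hm)))
  refine ⟨t, ht, fun r hr ε hε => ?_⟩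
  obtain ⟨χ, hχ, hχs, hχ1⟩ := hcut r hr
  have hε3 : ε / 3 ≠ 0 := by simp [hε.ne']
  obtain ⟨ε', hε', hCε'⟩ := exists_mul_le (C := C + 1) (δ := ε / 3)
    (ENNReal.add_ne_top.2 ⟨hC, ENNReal.one_ne_top⟩) hε3
  obtain ⟨ψ, hψ, hψε⟩ := h.exists_testFun_sobNorm_le hK hχ hχs hε'
  have hε3' : ε / 3 ≤ ε := ENNReal.div_le_of_le_mul (by
    calc ε = ε * 1 := (mul_one _).symm
      _ ≤ ε * 3 := by gcongr; norm_num)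
  have hsob : sobNorm (v * χ - ψ) (p₁ * χ + v * d₁ χ - d₁ ψ) (p₂ * χ + v * d₂ χ - d₂ ψ) < ε := by
    refine (hψε.trans ?_).trans_lt (hCε'.trans_le hε3')
    calc ε' = 1 * ε' := (one_mul _).symm
      _ ≤ (C + 1) * ε' := by gcongr; exact le_add_self
  refine ⟨ψ, hψ, ?_, ?_⟩
  · set V := ball c r \ closure Ω with hV
    have hVo : IsOpen V := isOpen_ball.sdiff isClosed_closure
    have hV1 : ∀ x ∈ V, χ x = 1 := fun x hx =>
      hχ1 x (Or.inl ⟨ball_subset_closedBall hx.1, fun hxΩ => hx.2 (subset_closure hxΩ)⟩)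
    have hV₁ : ∀ x ∈ V, d₁ χ x = 0 := fun x hx => d₁_eq_zero_of_eqOn hVo hV1 hx
    have hV₂ : ∀ x ∈ V, d₂ χ x = 0 := fun x hx => d₂_eq_zero_of_eqOn hVo hV1 hx
    have hres : ∀ f g : ℂ → ℂ, (∀ x ∈ V, f x = g x) →
        eLpNorm g 2 volume < ε → eLpNorm f 2 (volume.restrict V) < ε := by
      intro f g hfg hg
      refine lt_of_le_of_lt ?_ hg
      rw [eLpNorm_congr_ae (g := g) (by
        filter_upwards [ae_restrict_mem hVo.measurableSet] with x hx using hfg x hx)]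
      exact eLpNorm_mono_measure _ Measure.restrict_le_self
    refine ⟨hres _ (v * χ - ψ) (fun x hx => ?_) (lt_of_le_of_lt ?_ hsob),
      hres _ (p₁ * χ + v * d₁ χ - d₁ ψ) (fun x hx => ?_) (lt_of_le_of_lt ?_ hsob),
      hres _ (p₂ * χ + v * d₂ χ - d₂ ψ) (fun x hx => ?_) (lt_of_le_of_lt ?_ hsob)⟩
    · simp [hV1 x hx]
    · rw [sobNorm, add_assoc]; exact le_self_add
    · simp [hV1 x hx, hV₁ x hx]
    · exact le_add_right le_add_self
    · simp [hV1 x hx, hV₂ x hx]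
    · exact le_add_self
  · obtain ⟨n, hn, hn'⟩ : ∃ n, eLpNorm (φ n - t) 2 (bdry Ω) < ε / 3 ∧
        (2⁻¹ : ℝ≥0∞) ^ n / 2 < ε / 3 := by
      have h1 := hlim.eventually (gt_mem_nhds (pos_iff_ne_zero.2 hε3))
      have h2 : Filter.Tendsto (fun n : ℕ => (2⁻¹ : ℝ≥0∞) ^ n / 2) Filter.atTop (nhds 0) := by
        have := ENNReal.Tendsto.div_const (b := 2)
          (ENNReal.tendsto_pow_atTop_nhds_zero_of_lt_one (r := 2⁻¹) (by simp))
          (Or.inr (by simp))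
        simpa using this
      exact (h1.and (h2.eventually (gt_mem_nhds (pos_iff_ne_zero.2 hε3)))).exists
    have hb := hcmp χ₀ hχ₀ hχ₀s hχ₀1' χ hχ hχs (fun x hx => hχ1 x (Or.inr hx)) _ (hφ n) ψ hψ
    have hsplit : t - ψ = (t - φ n) + (φ n - ψ) := by abel
    have mφ : AEStronglyMeasurable (φ n) (bdry Ω) := (hφ n).1.continuous.aestronglyMeasurable
    have mψ : AEStronglyMeasurable ψ (bdry Ω) := hψ.1.continuous.aestronglyMeasurable
    rw [hsplit]
    refine (eLpNorm_add_le (ht.1.sub mφ) (mφ.sub mψ) (by norm_num)).trans_lt ?_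
    rw [eLpNorm_sub_comm, ← ENNReal.add_thirds ε, add_assoc]
    refine ENNReal.add_lt_add hn (hb.trans_lt ?_)
    rw [mul_add]
    refine ENNReal.add_lt_add ((hφs' n).trans hn') (lt_of_le_of_lt ?_ hCε')
    exact mul_le_mul' le_self_add hψε

end

/-! ### Restriction to `B ∖ closure Ω` -/

section

variable {c : ℂ} {R : ℝ} {K L : Set ℂ} {k2 : ℂ} {v p₁ p₂ : ℂ → ℂ}

theorem setIntegral_sdiff_eq (hK : IsClosed K) (hKL : K ⊆ L) {f : ℂ → ℂ}
    (hf : ∀ x ∈ L, f x = 0) : ∫ x in ball c R \ L, f x = ∫ x in ball c R \ K, f x := by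
  refine (setIntegral_eq_of_subset_of_forall_sdiff_eq_zero
    (measurableSet_ball.diff hK.measurableSet) (sdiff_subset_sdiff_right hKL) fun x hx => ?_).symm
  refine hf x ?_
  by_contra hxL
  exact hx.2 ⟨hx.1.1, hxL⟩

theorem laplacian_eq_zero_of_notMem_tsupport {φ : ℂ → ℂ} {x : ℂ} (hx : x ∉ tsupport φ) :
    (Δ φ) x = 0 := by
  have h : φ =ᶠ[nhds x] fun _ => 0 := notMem_tsupport_iff_eventuallyEq.1 hx
  rw [(InnerProductSpace.laplacian_congr_nhds h).eq_of_nhds]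
  simp

theorem InSolutionSpace.mono (h : InSolutionSpace c R K v p₁ p₂) (hK : IsClosed K)
    (hKL : K ⊆ L) : InSolutionSpace c R L v p₁ p₂ where
  memLp := h.memLp.mono_measure (Measure.restrict_mono (sdiff_subset_sdiff_right hKL) le_rfl)
  memLp₁ r hr := (h.memLp₁ r hr).mono_measure
    (Measure.restrict_mono (sdiff_subset_sdiff_right hKL) le_rfl)
  memLp₂ r hr := (h.memLp₂ r hr).mono_measure
    (Measure.restrict_mono (sdiff_subset_sdiff_right hKL) le_rfl)
  weakGradient φ hφ hs := by
    obtain ⟨h1, h2⟩ := h.weakGradient φ hφ (hs.trans (sdiff_subset_sdiff_right hKL))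
    have h0 : ∀ g : ℂ → ℂ, tsupport g ⊆ tsupport φ → ∀ x ∈ L, g x = 0 := fun g hg x hx =>
      image_eq_zero_of_notMem_tsupport fun hx' => (hs (hg hx')).2 hx
    have e := h0 φ subset_rfl
    have e₁ := h0 _ (tsupport_d₁_subset φ)
    have e₂ := h0 _ (tsupport_d₂_subset φ)
    rw [setIntegral_sdiff_eq hK hKL (fun x hx => by simp [e₁ x hx]),
      setIntegral_sdiff_eq hK hKL (fun x hx => by simp [e x hx]),
      setIntegral_sdiff_eq hK hKL (fun x hx => by simp [e₂ x hx]),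
      setIntegral_sdiff_eq hK hKL (fun x hx => by simp [e x hx])]
    exact ⟨h1, h2⟩

theorem HasCauchyData.mono {f ψ : ℤ → ℂ} (h : HasCauchyData c R K k2 v f ψ) (hK : IsClosed K)
    (hKL : K ⊆ L) : HasCauchyData c R L k2 v f ψ where
  dirichlet_mem := h.dirichlet_mem
  neumann_mem := h.neumann_mem
  green φ hφ hd := by
    rw [← h.green φ hφ (hd.mono_right hKL)]
    refine setIntegral_sdiff_eq hK hKL fun x hx => ?_
    have hx' : x ∉ tsupport φ := fun h' => disjoint_left.1 hd h' hx
    simp [laplacian_eq_zero_of_notMem_tsupport hx', image_eq_zero_of_notMem_tsupport hx']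

theorem weakForm_eq_zero_of_notMem {φ : ℂ → ℂ} {x : ℂ} (hx : x ∉ tsupport φ) :
    weakForm k2 v p₁ p₂ φ x = 0 := by
  simp [weakForm, image_eq_zero_of_notMem_tsupport hx,
    image_eq_zero_of_notMem_tsupport fun h => hx (tsupport_d₁_subset φ h),
    image_eq_zero_of_notMem_tsupport fun h => hx (tsupport_d₂_subset φ h)]

/-! ### The impedance data on `∂Ω` -/

theorem enorm_integral_mul_le {μ : Measure ℂ} {a φ : ℂ → ℂ} (ha : AEStronglyMeasurable a μ)
    (hφ : AEStronglyMeasurable φ μ) :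
    ‖∫ x, a x * φ x ∂μ‖ₑ ≤ eLpNorm a 2 μ * eLpNorm φ 2 μ := by
  refine (enorm_integral_le_lintegral_enorm _).trans ?_
  rw [← eLpNorm_one_eq_lintegral_enorm]
  have h := eLpNorm_smul_le_mul_eLpNorm (p := 2) (q := 2) (r := 1) hφ ha
  exact h

/-- A functional that is dominated by the `H¹` norm, up to a finite factor. -/
def IsH1Bounded (g : (ℂ → ℂ) → ℂ) : Prop :=
  ∃ C : ℝ≥0∞, C ≠ ⊤ ∧ ∀ φ ∈ TestFun, ‖g φ‖ₑ ≤ C * ENNReal.ofReal (h1Norm φ)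

theorem IsH1Bounded.sub {g g' : (ℂ → ℂ) → ℂ} (h : IsH1Bounded g) (h' : IsH1Bounded g') :
    IsH1Bounded (fun φ => g φ - g' φ) := by
  obtain ⟨C, hC, h⟩ := h
  obtain ⟨C', hC', h'⟩ := h'
  refine ⟨C + C', ENNReal.add_ne_top.2 ⟨hC, hC'⟩, fun φ hφ => ?_⟩
  rw [add_mul]
  exact enorm_sub_le.trans (add_le_add (h φ hφ) (h' φ hφ))

theorem IsH1Bounded.add {g g' : (ℂ → ℂ) → ℂ} (h : IsH1Bounded g) (h' : IsH1Bounded g') :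
    IsH1Bounded (fun φ => g φ + g' φ) := by
  obtain ⟨C, hC, h⟩ := h
  obtain ⟨C', hC', h'⟩ := h'
  refine ⟨C + C', ENNReal.add_ne_top.2 ⟨hC, hC'⟩, fun φ hφ => ?_⟩
  rw [add_mul]
  exact (enorm_add_le _ _).trans (add_le_add (h φ hφ) (h' φ hφ))

theorem IsH1Bounded.exists_norm_le {g : (ℂ → ℂ) → ℂ} (h : IsH1Bounded g) :
    ∃ C : ℝ, ∀ φ : TestFun, ‖g φ‖ ≤ C * h1Norm φ := by
  obtain ⟨C, hC, h⟩ := h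
  refine ⟨C.toReal, fun φ => ?_⟩
  have h1 : (0 : ℝ) ≤ h1Norm φ := Real.sqrt_nonneg _
  have := h φ φ.2
  rwa [← ENNReal.ofReal_toReal hC, ← ENNReal.ofReal_mul ENNReal.toReal_nonneg, ← ofReal_norm,
    ENNReal.ofReal_le_ofReal_iff (mul_nonneg ENNReal.toReal_nonneg h1)] at this

theorem isH1Bounded_integral {U : Set ℂ} {a : ℂ → ℂ} (ha : MemLp a 2 (volume.restrict U))
    {T : (ℂ → ℂ) → ℂ → ℂ} (hT : ∀ φ ∈ TestFun, T φ ∈ TestFun)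
    (hb : ∀ φ ∈ TestFun, eLpNorm (T φ) 2 volume ≤ ENNReal.ofReal (h1Norm φ)) :
    IsH1Bounded (fun φ => ∫ x in U, a x * T φ x) := by
  refine ⟨eLpNorm a 2 (volume.restrict U), ha.2.ne, fun φ hφ => ?_⟩
  refine (enorm_integral_mul_le ha.1 (hT φ hφ).1.continuous.aestronglyMeasurable).trans ?_
  gcongr
  exact (eLpNorm_mono_measure _ Measure.restrict_le_self).trans (hb φ hφ)

/-- The functional `φ ↦ ∫ (∇v·∇(χφ) - k²vχφ)`, for a cutoff `χ`, is bounded on `H¹(ℝ²)`. -/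
theorem InSolutionSpace.isH1Bounded_weakForm (h : InSolutionSpace c R K v p₁ p₂)
    (hK : IsClosed K) {χ : ℂ → ℂ} (hχ : χ ∈ TestFun) (hχs : tsupport χ ⊆ ball c R) :
    IsH1Bounded (fun φ => ∫ x in ball c R \ K, weakForm k2 v p₁ p₂ (χ * φ) x) := by
  have s₁ := (tsupport_d₁_subset χ).trans hχs
  have s₂ := (tsupport_d₂_subset χ).trans hχs
  have a₁ := memLp_mul_testFun hK h.memLp₁ hχ hχs
  have a₂ := memLp_mul_testFun hK h.memLp₂ hχ hχs
  have a₀ := ((memLp_mul_testFun hK h.memLp₁ (d₁_mem_testFun hχ) s₁).add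
    (memLp_mul_testFun hK h.memLp₂ (d₂_mem_testFun hχ) s₂)).sub
    ((memLp_mul_testFun hK h.memLp_ball hχ hχs).const_mul k2)
  have b₁ := isH1Bounded_integral a₁ (T := d₁) (fun _ => d₁_mem_testFun)
    fun φ hφ => (eLpNorm_le_h1Norm hφ).2.1
  have b₂ := isH1Bounded_integral a₂ (T := d₂) (fun _ => d₂_mem_testFun)
    fun φ hφ => (eLpNorm_le_h1Norm hφ).2.2
  have b₀ := isH1Bounded_integral a₀ (T := id) (fun _ h => h)
    fun φ hφ => (eLpNorm_le_h1Norm hφ).1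
  obtain ⟨C, hC, hb⟩ := (b₁.add b₂).add b₀
  refine ⟨C, hC, fun φ hφ => ?_⟩
  convert hb φ hφ using 2
  have hl : ∀ {p g : ℂ → ℂ}, MemLp p 2 (volume.restrict (ball c R \ K)) → g ∈ TestFun →
      Integrable (fun x => p x * g x) (volume.restrict (ball c R \ K)) := fun hp hg =>
    hp.integrable_mul (memLp_of_mem_testFun hg 2 _)
  have i₁ := hl a₁ (d₁_mem_testFun hφ)
  have i₂ := hl a₂ (d₂_mem_testFun hφ)
  have i₀ := hl a₀ hφ
  have i₁₂ : Integrable (fun x => (p₁ * χ) x * d₁ φ x + (p₂ * χ) x * d₂ φ x)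
      (volume.restrict (ball c R \ K)) := i₁.add i₂
  simp only [id_eq]
  rw [← integral_add i₁ i₂, ← integral_add i₁₂ i₀]
  congr 1
  ext x
  rw [weakForm, d₁_mul (differentiable_of_mem_testFun hχ) (differentiable_of_mem_testFun hφ),
    d₂_mul (differentiable_of_mem_testFun hχ) (differentiable_of_mem_testFun hφ)]
  simp only [Pi.add_apply, Pi.mul_apply, Pi.sub_apply]
  ring

theorem memLp_mul_of_continuousOn {Ω : Set ℂ} (hΩ : IsLipschitzDomain Ω) {η t : ℂ → ℂ}
    (hη : ContinuousOn η (frontier Ω)) (ht : MemLp t 2 (bdry Ω)) : MemLp (η * t) 2 (bdry Ω) := by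
  obtain ⟨C, hC⟩ := hΩ.isCompact_frontier.exists_bound_of_continuousOn hη
  have h1 : MemLp η ⊤ (bdry Ω) := by
    refine memLp_top_of_bound (hη.aestronglyMeasurable isClosed_frontier.measurableSet) C ?_
    filter_upwards [ae_restrict_mem isClosed_frontier.measurableSet] with x hx using hC x hx
  exact ht.mul h1

theorem integrable_bdry {Ω : Set ℂ} (hΩ : IsLipschitzDomain Ω) {η t φ : ℂ → ℂ}
    (hη : ContinuousOn η (frontier Ω)) (ht : MemLp t 2 (bdry Ω)) (hφ : φ ∈ TestFun) :
    Integrable (fun x => η x * t x * φ x) (bdry Ω) := by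
  have := hΩ.isFiniteMeasure_bdry
  exact (memLp_mul_of_continuousOn hΩ hη ht).integrable_mul (memLp_of_mem_testFun hφ 2 _)

theorem isH1Bounded_bdry {Ω : Set ℂ} (hΩ : IsLipschitzDomain Ω) {a : ℂ → ℂ}
    (ha : MemLp a 2 (bdry Ω)) : IsH1Bounded (fun φ => ∫ x, a x * φ x ∂(bdry Ω)) := by
  obtain ⟨C, hC, h⟩ := hΩ.exists_trace_le
  refine ⟨eLpNorm a 2 (bdry Ω) * (C * 3),
    ENNReal.mul_ne_top ha.2.ne (ENNReal.mul_ne_top hC (by simp)), fun φ hφ => ?_⟩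
  refine (enorm_integral_mul_le ha.1 hφ.1.continuous.aestronglyMeasurable).trans ?_
  rw [mul_assoc, mul_assoc]
  refine mul_le_mul_right ((h φ hφ).trans (mul_le_mul_right ?_ C)) _
  obtain ⟨h0, h1, h2⟩ := eLpNorm_le_h1Norm hφ
  refine (add_le_add (add_le_add h0 h1) h2).trans_eq ?_
  ring

/-- A solution of the Helmholtz equation in `B ∖ K`, `K ⊆ Ω`, restricted to `B ∖ closure Ω`, solves
the impedance problem there, for some impedance data in `H^{-1/2}(∂Ω)`. -/
theorem exists_solvesImpedance (hK : IsClosed K) {Ω : Set ℂ} (hΩ : IsLipschitzDomain Ω)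
    (hKΩ : K ⊆ Ω) (hΩB : closure Ω ⊆ ball c R) {η : ℂ → ℂ} (hη : ContinuousOn η (frontier Ω))
    (h : InSolutionSpace c R K v p₁ p₂)
    (hw : ∀ φ ∈ TestFun, tsupport φ ⊆ ball c R \ K →
      ∫ x in ball c R \ K, weakForm k2 v p₁ p₂ φ x = 0)
    {f ψ : ℤ → ℂ} (hC : HasCauchyData c R K k2 v f ψ) :
    ∃ g : HNegHalf Ω, SolvesImpedance c R Ω η k2 f g ψ v := by
  have hKΩ' : K ⊆ closure Ω := hKΩ.trans subset_closure
  have h' := h.mono hK hKΩ'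
  obtain ⟨t, ht⟩ := h.exists_isTrace hK hΩ hKΩ hΩB
  have hw' : ∀ φ ∈ TestFun, tsupport φ ⊆ ball c R \ closure Ω →
      ∫ x in ball c R \ closure Ω, weakForm k2 v p₁ p₂ φ x = 0 := by
    intro φ hφ hs
    rw [setIntegral_sdiff_eq hK hKΩ' fun x hx => weakForm_eq_zero_of_notMem fun hx' => (hs hx').2 hx]
    exact hw φ hφ (hs.trans (sdiff_subset_sdiff_right hKΩ'))
  obtain ⟨χ, hχ, hχs, hχ1⟩ := exists_cutoff hΩ.isCompact_frontier isOpen_ball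
    (frontier_subset_closure.trans hΩB)
  have hχφ : ∀ φ ∈ TestFun, χ * φ ∈ TestFun ∧ tsupport (χ * φ) ⊆ ball c R := fun φ hφ =>
    ⟨mul_mem_testFun hχ.1 hφ, tsupport_mul_subset_left.trans hχs⟩
  let g : TestFun →ₗ[ℂ] ℂ :=
    { toFun := fun φ => (∫ x, η x * t x * (φ : ℂ → ℂ) x ∂(bdry Ω)) -
        ∫ x in ball c R \ closure Ω, weakForm k2 v p₁ p₂ (χ * φ) x
      map_add' := by
        rintro ⟨φ, hφ⟩ ⟨φ', hφ'⟩
        have e1 := integral_add (integrable_bdry hΩ hη ht.1 hφ) (integrable_bdry hΩ hη ht.1 hφ')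
        have e2 := integral_add (μ := volume.restrict (ball c R \ closure Ω))
          (integrable_weakForm (k2 := k2) isClosed_closure h' (hχφ φ hφ).1 (hχφ φ hφ).2)
          (integrable_weakForm (k2 := k2) isClosed_closure h' (hχφ φ' hφ').1 (hχφ φ' hφ').2)
        have e3 : ∀ x, weakForm k2 v p₁ p₂ (χ * (φ + φ')) x =
            weakForm k2 v p₁ p₂ (χ * φ) x + weakForm k2 v p₁ p₂ (χ * φ') x := by
          intro x
          rw [mul_add, weakForm, d₁_add (differentiable_of_mem_testFun (hχφ φ hφ).1)
            (differentiable_of_mem_testFun (hχφ φ' hφ').1),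
            d₂_add (differentiable_of_mem_testFun (hχφ φ hφ).1)
            (differentiable_of_mem_testFun (hχφ φ' hφ').1)]
          simp only [weakForm, Pi.add_apply]
          ring
        simp only [Submodule.coe_add, e3, e2]
        simp only [Pi.add_apply, mul_add, e1]
        ring
      map_smul' := by
        rintro a ⟨φ, hφ⟩
        have e3 : ∀ x, weakForm k2 v p₁ p₂ (χ * (a • φ)) x =
            a * weakForm k2 v p₁ p₂ (χ * φ) x := by
          intro x
          rw [mul_smul_comm, weakForm, d₁_const_smul a (differentiable_of_mem_testFun (hχφ φ hφ).1),
            d₂_const_smul a (differentiable_of_mem_testFun (hχφ φ hφ).1)]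
          simp only [weakForm, Pi.smul_apply, smul_eq_mul]
          ring
        have e1 : ∀ x, η x * t x * (a • φ) x = a * (η x * t x * φ x) := by
          intro x
          simp only [Pi.smul_apply, smul_eq_mul]
          ring
        simp only [Submodule.coe_smul, e3, e1, integral_const_mul, RingHom.id_apply, smul_eq_mul]
        ring }
  have hg : g ∈ HNegHalf Ω := by
    refine ⟨fun φ h0 => ?_, ?_⟩
    · have e1 : ∫ x, η x * t x * (φ : ℂ → ℂ) x ∂(bdry Ω) = 0 := by
        refine integral_eq_zero_of_ae ?_
        filter_upwards [ae_restrict_mem isClosed_frontier.measurableSet] with x hx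
        simp [h0 x hx]
      have e2 := integral_weakForm_eq_zero hΩ.isOpen h' hw' (hχφ φ φ.2).1 (hχφ φ φ.2).2
        fun x hx => by simp [h0 x hx]
      show (_ - _ : ℂ) = 0
      rw [e1, e2, sub_zero]
    · have b1 := isH1Bounded_bdry hΩ (memLp_mul_of_continuousOn hΩ hη ht.1)
      have b2 := h'.isH1Bounded_weakForm (k2 := k2) isClosed_closure hχ hχs
      exact (b1.sub b2).exists_norm_le
  refine ⟨⟨g, hg⟩, p₁, p₂, t, h', ht, fun φ hφs => ?_, hC.mono hK hKΩ'⟩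
  have e1 := integral_weakForm_eq_zero (φ := (φ : ℂ → ℂ) - χ * φ) hΩ.isOpen h' hw'
    (TestFun.sub_mem φ.2 (hχφ φ φ.2).1) (((tsupport_sub _ _).trans
      (union_subset hφs (hχφ φ φ.2).2))) fun x hx => by simp [hχ1 x hx]
  rw [integral_weakForm_sub isClosed_closure h' φ.2 hφs (hχφ φ φ.2).1 (hχφ φ φ.2).2] at e1
  show ∫ x in ball c R \ closure Ω, weakForm k2 v p₁ p₂ φ x = _ - (_ - _)
  rw [sub_sub_cancel]
  exact sub_eq_zero.1 e1

end

/-! ### Linearity of the impedance problem -/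

section

variable {c : ℂ} {R : ℝ} {K : Set ℂ} {k2 : ℂ} {v p₁ p₂ v' p₁' p₂' : ℂ → ℂ}

theorem InSolutionSpace.add (h : InSolutionSpace c R K v p₁ p₂)
    (h' : InSolutionSpace c R K v' p₁' p₂') (hK : IsClosed K) :
    InSolutionSpace c R K (v + v') (p₁ + p₁') (p₂ + p₂') where
  memLp := h.memLp.add h'.memLp
  memLp₁ r hr := (h.memLp₁ r hr).add (h'.memLp₁ r hr)
  memLp₂ r hr := (h.memLp₂ r hr).add (h'.memLp₂ r hr)
  weakGradient φ hφ hs := by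
    have hsB := hs.trans sdiff_subset
    obtain ⟨e1, e2⟩ := h.weakGradient φ hφ hs
    obtain ⟨e1', e2'⟩ := h'.weakGradient φ hφ hs
    have key : ∀ {p p' g : ℂ → ℂ}, (∀ r < R, MemLp p 2 (volume.restrict (ball c r \ K))) →
        (∀ r < R, MemLp p' 2 (volume.restrict (ball c r \ K))) → g ∈ TestFun →
        tsupport g ⊆ ball c R → ∫ x in ball c R \ K, (p + p') x * g x =
          (∫ x in ball c R \ K, p x * g x) + ∫ x in ball c R \ K, p' x * g x := by
      intro p p' g hp hp' hg hgs
      have i : Integrable (fun x => p x * g x) (volume.restrict (ball c R \ K)) :=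
        integrable_mul_testFun hK hp hg hgs
      have i' : Integrable (fun x => p' x * g x) (volume.restrict (ball c R \ K)) :=
        integrable_mul_testFun hK hp' hg hgs
      rw [← integral_add i i']
      simp only [Pi.add_apply, add_mul]
    rw [key h.memLp_ball h'.memLp_ball (d₁_mem_testFun hφ) ((tsupport_d₁_subset φ).trans hsB),
      key h.memLp_ball h'.memLp_ball (d₂_mem_testFun hφ) ((tsupport_d₂_subset φ).trans hsB),
      key h.memLp₁ h'.memLp₁ hφ hsB, key h.memLp₂ h'.memLp₂ hφ hsB, e1, e2, e1', e2', neg_add,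
      neg_add]
    exact ⟨rfl, rfl⟩

theorem InSolutionSpace.smul (h : InSolutionSpace c R K v p₁ p₂) (a : ℂ) :
    InSolutionSpace c R K (a • v) (a • p₁) (a • p₂) where
  memLp := h.memLp.const_smul a
  memLp₁ r hr := (h.memLp₁ r hr).const_smul a
  memLp₂ r hr := (h.memLp₂ r hr).const_smul a
  weakGradient φ hφ hs := by
    obtain ⟨e1, e2⟩ := h.weakGradient φ hφ hs
    simp only [Pi.smul_apply, smul_eq_mul, mul_assoc, integral_const_mul, e1, e2, mul_neg]
    exact ⟨trivial, trivial⟩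

theorem weakForm_add (φ : ℂ → ℂ) (x : ℂ) : weakForm k2 (v + v') (p₁ + p₁') (p₂ + p₂') φ x =
    weakForm k2 v p₁ p₂ φ x + weakForm k2 v' p₁' p₂' φ x := by
  simp only [weakForm, Pi.add_apply]
  ring

theorem weakForm_smul (a : ℂ) (φ : ℂ → ℂ) (x : ℂ) :
    weakForm k2 (a • v) (a • p₁) (a • p₂) φ x = a * weakForm k2 v p₁ p₂ φ x := by
  simp only [weakForm, Pi.smul_apply, smul_eq_mul]
  ring

theorem eLpNorm_add_sub_add_lt {μ : Measure ℂ} {f f' g g' : ℂ → ℂ}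
    (hf : AEStronglyMeasurable f μ) (hf' : AEStronglyMeasurable f' μ)
    (hg : AEStronglyMeasurable g μ) (hg' : AEStronglyMeasurable g' μ) {ε : ℝ≥0∞}
    (h : eLpNorm (f - g) 2 μ < ε / 2) (h' : eLpNorm (f' - g') 2 μ < ε / 2) :
    eLpNorm (f + f' - (g + g')) 2 μ < ε := by
  rw [add_sub_add_comm, ← ENNReal.add_halves ε]
  exact (eLpNorm_add_le (hf.sub hg) (hf'.sub hg') (by norm_num)).trans_lt
    (ENNReal.add_lt_add h h')

theorem eLpNorm_smul_sub_smul_lt {μ : Measure ℂ} {f g : ℂ → ℂ} {a : ℂ} {ε ε' : ℝ≥0∞}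
    (hε : ‖a‖ₑ * ε' < ε) (h : eLpNorm (f - g) 2 μ < ε') :
    eLpNorm (a • f - a • g) 2 μ < ε := by
  rw [← smul_sub]
  exact (eLpNorm_const_smul_le.trans (mul_le_mul_right h.le _)).trans_lt hε

theorem IsTrace.add {Ω : Set ℂ} {t t' : ℂ → ℂ} (h : InSolutionSpace c R (closure Ω) v p₁ p₂)
    (h' : InSolutionSpace c R (closure Ω) v' p₁' p₂') (ht : IsTrace c R Ω v p₁ p₂ t)
    (ht' : IsTrace c R Ω v' p₁' p₂' t') :
    IsTrace c R Ω (v + v') (p₁ + p₁') (p₂ + p₂') (t + t') := by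
  refine ⟨ht.1.add ht'.1, fun r hr ε hε => ?_⟩
  have hε2 : 0 < ε / 2 := ENNReal.half_pos hε.ne'
  obtain ⟨φ, hφ, ⟨a0, a1, a2⟩, a3⟩ := ht.2 r hr _ hε2
  obtain ⟨φ', hφ', ⟨b0, b1, b2⟩, b3⟩ := ht'.2 r hr _ hε2
  have hd := differentiable_of_mem_testFun hφ
  have hd' := differentiable_of_mem_testFun hφ'
  have m : ∀ {g : ℂ → ℂ}, g ∈ TestFun → ∀ μ : Measure ℂ, AEStronglyMeasurable g μ :=
    fun hg _ => hg.1.continuous.aestronglyMeasurable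
  refine ⟨φ + φ', TestFun.add_mem hφ hφ', ⟨?_, ?_, ?_⟩, ?_⟩
  · exact eLpNorm_add_sub_add_lt (h.memLp_ball r hr).1 (h'.memLp_ball r hr).1 (m hφ _) (m hφ' _)
      a0 b0
  · rw [d₁_add hd hd']
    exact eLpNorm_add_sub_add_lt (h.memLp₁ r hr).1 (h'.memLp₁ r hr).1 (m (d₁_mem_testFun hφ) _)
      (m (d₁_mem_testFun hφ') _) a1 b1
  · rw [d₂_add hd hd']
    exact eLpNorm_add_sub_add_lt (h.memLp₂ r hr).1 (h'.memLp₂ r hr).1 (m (d₂_mem_testFun hφ) _)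
      (m (d₂_mem_testFun hφ') _) a2 b2
  · exact eLpNorm_add_sub_add_lt ht.1.1 ht'.1.1 (m hφ _) (m hφ' _) a3 b3

theorem IsTrace.smul {Ω : Set ℂ} {t : ℂ → ℂ} (ht : IsTrace c R Ω v p₁ p₂ t) (a : ℂ) :
    IsTrace c R Ω (a • v) (a • p₁) (a • p₂) (a • t) := by
  refine ⟨ht.1.const_smul a, fun r hr ε hε => ?_⟩
  obtain ⟨ε', hε', haε⟩ := exists_mul_le (C := ‖a‖ₑ) (by simp) hε.ne'
  obtain ⟨φ, hφ, ⟨a0, a1, a2⟩, a3⟩ := ht.2 r hr ε' (pos_iff_ne_zero.2 hε')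
  have hd := differentiable_of_mem_testFun hφ
  refine ⟨a • φ, TestFun.smul_mem a hφ, ⟨eLpNorm_smul_sub_smul_lt haε a0, ?_, ?_⟩,
    eLpNorm_smul_sub_smul_lt haε a3⟩
  · rw [d₁_const_smul a hd]
    exact eLpNorm_smul_sub_smul_lt haε a1
  · rw [d₂_const_smul a hd]
    exact eLpNorm_smul_sub_smul_lt haε a2

theorem continuous_laplacian {φ : ℂ → ℂ} (h : φ ∈ TestFun) : Continuous (Δ φ) := by
  rw [InnerProductSpace.laplacian_eq_iteratedFDeriv_complexPlane]
  have h2 : Continuous (iteratedFDeriv ℝ 2 φ) :=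
    h.1.continuous_iteratedFDeriv (by norm_cast)
  exact (continuous_eval_const _ |>.comp h2).add (continuous_eval_const _ |>.comp h2)

theorem HasCauchyData.add {f ψ f' ψ' : ℤ → ℂ} (h : HasCauchyData c R K k2 v f ψ)
    (h' : HasCauchyData c R K k2 v' f' ψ') (hv : MemLp v 2 (volume.restrict (ball c R \ K)))
    (hv' : MemLp v' 2 (volume.restrict (ball c R \ K))) :
    HasCauchyData c R K k2 (v + v') (f + f') (ψ + ψ') where
  dirichlet_mem := h.dirichlet_mem.add h'.dirichlet_mem
  neumann_mem := h.neumann_mem.add h'.neumann_mem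
  green φ hφ hd := by
    have hc : Continuous fun x => (Δ φ) x + k2 * φ x :=
      (continuous_laplacian hφ).add (continuous_const.mul hφ.1.continuous)
    have hs : HasCompactSupport fun x => (Δ φ) x + k2 * φ x := by
      refine HasCompactSupport.intro hφ.2 fun x hx => ?_
      simp [laplacian_eq_zero_of_notMem_tsupport hx, image_eq_zero_of_notMem_tsupport hx]
    have hm : MemLp (fun x => (Δ φ) x + k2 * φ x) 2 (volume.restrict (ball c R \ K)) :=
      hc.memLp_of_hasCompactSupport hs
    have i : Integrable (fun x => v x * ((Δ φ) x + k2 * φ x))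
        (volume.restrict (ball c R \ K)) := hv.integrable_mul hm
    have i' : Integrable (fun x => v' x * ((Δ φ) x + k2 * φ x))
        (volume.restrict (ball c R \ K)) := hv'.integrable_mul hm
    simp only [Pi.add_apply, add_mul]
    rw [integral_add i i', h.green φ hφ hd, h'.green φ hφ hd,
      circlePairing_add R (by norm_num) h.dirichlet_mem h'.dirichlet_mem
        (contDiff_normalOnCircle c R hφ) (periodic_normalOnCircle c R φ),
      circlePairing_add R (by norm_num) h.neumann_mem h'.neumann_mem
        (contDiff_onCircle c R hφ) (periodic_onCircle c R φ)]
    ring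

theorem HasCauchyData.smul {f ψ : ℤ → ℂ} (h : HasCauchyData c R K k2 v f ψ) (a : ℂ) :
    HasCauchyData c R K k2 (a • v) (a • f) (a • ψ) where
  dirichlet_mem := h.dirichlet_mem.smul a
  neumann_mem := h.neumann_mem.smul a
  green φ hφ hd := by
    simp only [Pi.smul_apply, smul_eq_mul, mul_assoc, integral_const_mul, h.green φ hφ hd,
      circlePairing_smul]
    ring

theorem SolvesImpedance.add {Ω : Set ℂ} (hΩ : IsLipschitzDomain Ω) {η : ℂ → ℂ}
    (hη : ContinuousOn η (frontier Ω)) {f f' ψ ψ' : ℤ → ℂ} {g g' : HNegHalf Ω}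
    (h : SolvesImpedance c R Ω η k2 f g ψ v) (h' : SolvesImpedance c R Ω η k2 f' g' ψ' v') :
    SolvesImpedance c R Ω η k2 (f + f') (g + g') (ψ + ψ') (v + v') := by
  obtain ⟨p₁, p₂, t, hs, ht, hw, hC⟩ := h
  obtain ⟨p₁', p₂', t', hs', ht', hw', hC'⟩ := h'
  refine ⟨p₁ + p₁', p₂ + p₂', t + t', hs.add hs' isClosed_closure, ht.add hs hs' ht',
    fun φ hφ => ?_, hC.add hC' hs.memLp hs'.memLp⟩
  have e := hw φ hφ
  have e' := hw' φ hφ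
  change ∫ x in ball c R \ closure Ω, weakForm k2 (v + v') (p₁ + p₁') (p₂ + p₂') φ x = _
  change ∫ x in ball c R \ closure Ω, weakForm k2 v p₁ p₂ φ x = _ at e
  change ∫ x in ball c R \ closure Ω, weakForm k2 v' p₁' p₂' φ x = _ at e'
  simp only [weakForm_add]
  rw [integral_add (integrable_weakForm isClosed_closure hs φ.2 hφ)
    (integrable_weakForm isClosed_closure hs' φ.2 hφ), e, e']
  simp only [Pi.add_apply, mul_add, add_mul]
  rw [integral_add (integrable_bdry hΩ hη ht.1 φ.2) (integrable_bdry hΩ hη ht'.1 φ.2)]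
  simp only [Submodule.coe_add, LinearMap.add_apply]
  ring

theorem SolvesImpedance.smul {Ω : Set ℂ} {η : ℂ → ℂ} {f ψ : ℤ → ℂ} {g : HNegHalf Ω}
    (h : SolvesImpedance c R Ω η k2 f g ψ v) (a : ℂ) :
    SolvesImpedance c R Ω η k2 (a • f) (a • g) (a • ψ) (a • v) := by
  obtain ⟨p₁, p₂, t, hs, ht, hw, hC⟩ := h
  refine ⟨a • p₁, a • p₂, a • t, hs.smul a, ht.smul a, fun φ hφ => ?_, hC.smul a⟩
  have e := hw φ hφ
  change ∫ x in ball c R \ closure Ω, weakForm k2 (a • v) (a • p₁) (a • p₂) φ x = _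
  change ∫ x in ball c R \ closure Ω, weakForm k2 v p₁ p₂ φ x = _ at e
  simp only [weakForm_smul, integral_const_mul]
  rw [e]
  have e2 : ∀ x, η x * (a • t) x * (φ : ℂ → ℂ) x = a * (η x * t x * (φ : ℂ → ℂ) x) := by
    intro x
    simp only [Pi.smul_apply, smul_eq_mul]
    ring
  simp only [e2, integral_const_mul, Submodule.coe_smul, LinearMap.smul_apply, smul_eq_mul]
  ring

theorem SolvesImpedance.sub {Ω : Set ℂ} (hΩ : IsLipschitzDomain Ω) {η : ℂ → ℂ}
    (hη : ContinuousOn η (frontier Ω)) {f f' ψ ψ' : ℤ → ℂ} {g g' : HNegHalf Ω}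
    (h : SolvesImpedance c R Ω η k2 f g ψ v) (h' : SolvesImpedance c R Ω η k2 f' g' ψ' v') :
    SolvesImpedance c R Ω η k2 (f - f') (g - g') (ψ - ψ') (v - v') := by
  have := h.add hΩ hη (h'.smul (-1))
  have hg : g + (-1 : ℂ) • g' = g - g' := by module
  simpa only [hg, neg_smul, one_smul, ← sub_eq_add_neg] using this

theorem solvesImpedance_zero (Ω : Set ℂ) (η : ℂ → ℂ) :
    SolvesImpedance c R Ω η k2 0 0 0 0 := by
  refine ⟨0, 0, 0, ⟨MemLp.zero, fun φ _ _ => by simp, fun _ _ => MemLp.zero,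
    fun _ _ => MemLp.zero⟩, ⟨MemLp.zero, fun r _ ε hε => ⟨0, TestFun.zero_mem, ?_⟩⟩,
    fun φ _ => by simp, ⟨memHs_zero _, memHs_zero _, fun φ _ _ => by simp⟩⟩
  have h1 : d₁ (0 : ℂ → ℂ) = 0 := by ext x; simp [d₁]
  have h2 : d₂ (0 : ℂ → ℂ) = 0 := by ext x; simp [d₂]
  simp [H1Close, h1, h2, hε]

/-! ### The operators on `∂B` -/

theorem SolvesImpedance.cauchyData {Ω : Set ℂ} {η : ℂ → ℂ} {f ψ : ℤ → ℂ} {g : HNegHalf Ω}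
    (h : SolvesImpedance c R Ω η k2 f g ψ v) : HasCauchyData c R (closure Ω) k2 v f ψ := by
  obtain ⟨_, _, _, _, _, _, hC⟩ := h
  exact hC

theorem dtn_eq (hR : 0 < R) {Ω : Set ℂ} (hΩB : closure Ω ⊆ ball c R) {η : ℂ → ℂ}
    (hu : UniquelySolvable c R Ω η k2) {f ψ : ℤ → ℂ} (hf : MemHs (-1 / 2) f)
    (h : SolvesImpedance c R Ω η k2 f 0 ψ v) : dtn c R Ω η k2 f = ψ := by
  have hex : ∃ ψ : ℤ → ℂ, ∃ v : ℂ → ℂ, SolvesImpedance c R Ω η k2 f 0 ψ v := ⟨ψ, v, h⟩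
  rw [dtn, dif_pos hex]
  obtain ⟨w, hw⟩ := hex.choose_spec
  exact hw.cauchyData.neumann_unique hR isClosed_closure hΩB h.cauchyData
    ((hu f hf).2 _ _ _ _ hw h)

theorem opG_eq (hR : 0 < R) {Ω : Set ℂ} (hΩ : IsLipschitzDomain Ω) (hΩB : closure Ω ⊆ ball c R)
    {η : ℂ → ℂ} (hη : ContinuousOn η (frontier Ω)) (hG : NotEigenvalue c R Ω η k2)
    {g : HNegHalf Ω} {ψ : ℤ → ℂ} (h : SolvesImpedance c R Ω η k2 0 g ψ v) :
    opG c R Ω η k2 g = ψ := by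
  have hex : ∃ ψ : ℤ → ℂ, ∃ v : ℂ → ℂ, SolvesImpedance c R Ω η k2 0 g ψ v := ⟨ψ, v, h⟩
  rw [opG, dif_pos hex]
  obtain ⟨w, hw⟩ := hex.choose_spec
  refine hw.cauchyData.neumann_unique hR isClosed_closure hΩB h.cauchyData ?_
  have hd := hw.sub hΩ hη h
  rw [sub_zero, sub_self] at hd
  filter_upwards [hG _ _ hd] with x hx
  exact sub_eq_zero.1 hx

/-- The range of `G(k², Ω)` is the set of Neumann data of the solutions with `v = 0` on `∂B`. It
does not matter whether the problem is solvable for every `g`: where it is not, `opG` has the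
value `0`, the Neumann datum of `v = 0`. -/
theorem mem_range_opG_iff (hR : 0 < R) {Ω : Set ℂ} (hΩ : IsLipschitzDomain Ω)
    (hΩB : closure Ω ⊆ ball c R) {η : ℂ → ℂ} (hη : ContinuousOn η (frontier Ω))
    (hG : NotEigenvalue c R Ω η k2) {ψ : ℤ → ℂ} :
    ψ ∈ range (opG c R Ω η k2) ↔
      ∃ (g : HNegHalf Ω) (v : ℂ → ℂ), SolvesImpedance c R Ω η k2 0 g ψ v := by
  constructor
  · rintro ⟨g, rfl⟩
    by_cases hex : ∃ ψ : ℤ → ℂ, ∃ v : ℂ → ℂ, SolvesImpedance c R Ω η k2 0 g ψ v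
    · rw [opG, dif_pos hex]
      exact ⟨g, hex.choose_spec⟩
    · rw [opG, dif_neg hex]
      exact ⟨0, 0, solvesImpedance_zero Ω η⟩
  · rintro ⟨g, v, h⟩
    exact ⟨g, opG_eq hR hΩ hΩB hη hG h⟩

/-- Two solutions of the Helmholtz equation near `∂B`, with the same Dirichlet data and with holes
inside `Ω`, have Neumann data that differ by an element of the range of `G(k², Ω)`. -/
theorem smul_sub_mem_range_opG (hR : 0 < R) {Ω : Set ℂ} (hΩ : IsLipschitzDomain Ω)
    (hΩB : closure Ω ⊆ ball c R) {η : ℂ → ℂ} (hη : ContinuousOn η (frontier Ω))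
    (hG : NotEigenvalue c R Ω η k2) {f ψ ψ' : ℤ → ℂ} {g g' : HNegHalf Ω}
    (h : SolvesImpedance c R Ω η k2 f g ψ v) (h' : SolvesImpedance c R Ω η k2 f g' ψ' v')
    (a : ℂ) : a • (ψ - ψ') ∈ range (opG c R Ω η k2) := by
  have hd := (h.sub hΩ hη h').smul a
  rw [sub_self, smul_zero] at hd
  exact (mem_range_opG_iff hR hΩ hΩB hη hG).2 ⟨_, _, hd⟩

/-- For elements that differ by a member of the range of `G(k², Ω)`, a linear subspace, belonging
to the range is equivalent. -/
theorem mem_range_opG_congr (hR : 0 < R) {Ω : Set ℂ} (hΩ : IsLipschitzDomain Ω)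
    (hΩB : closure Ω ⊆ ball c R) {η : ℂ → ℂ} (hη : ContinuousOn η (frontier Ω))
    (hG : NotEigenvalue c R Ω η k2) {ψ ψ' : ℤ → ℂ} (h : ψ - ψ' ∈ range (opG c R Ω η k2)) :
    ψ ∈ range (opG c R Ω η k2) ↔ ψ' ∈ range (opG c R Ω η k2) := by
  simp only [mem_range_opG_iff hR hΩ hΩB hη hG] at h ⊢
  obtain ⟨g, v, h⟩ := h
  constructor
  · rintro ⟨g', v', h'⟩
    have := h'.sub hΩ hη h
    rw [sub_sub_cancel, sub_zero] at this
    exact ⟨_, _, this⟩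
  · rintro ⟨g', v', h'⟩
    have := h.add hΩ hη h'
    rw [sub_add_cancel, zero_add] at this
    exact ⟨_, _, this⟩

/-- The solution of the problem in `B ∖ closure D` restricts to a solution of an impedance problem
in `B ∖ closure Ω`. -/
theorem SolvesDirichlet.exists_solvesImpedance {Ω D : Set ℂ} (hΩ : IsLipschitzDomain Ω)
    (hDΩ : closure D ⊆ Ω) (hΩB : closure Ω ⊆ ball c R) {η : ℂ → ℂ}
    (hη : ContinuousOn η (frontier Ω)) {σ q : ℂ} (hσ : σ ≠ 0) {f ψ : ℤ → ℂ}
    (h : SolvesDirichlet c R D σ q f ψ v) :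
    ∃ g : HNegHalf Ω, SolvesImpedance c R Ω η (q / σ) f g ψ v := by
  obtain ⟨p₁, p₂, hs, hw, -, hC⟩ := h
  refine OneWave.exists_solvesImpedance isClosed_closure hΩ hDΩ hΩB hη hs (fun φ hφ hφs => ?_) hC
  have e : ∀ x, σ * (p₁ x * d₁ φ x + p₂ x * d₂ φ x) - q * v x * φ x =
      σ * weakForm (q / σ) v p₁ p₂ φ x := by
    intro x
    rw [weakForm]
    field_simp
  have := hw φ hφ hφs
  simp only [e, integral_const_mul] at this
  exact (mul_eq_zero.1 this).resolve_left hσ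

/-- The solution of the impedance problem in `B ∖ closure Bhat` restricts to a solution of an
impedance problem in `B ∖ closure Ω`. -/
theorem SolvesImpedance.exists_solvesImpedance {Ω Bhat : Set ℂ} (hΩ : IsLipschitzDomain Ω)
    (hBΩ : closure Bhat ⊆ Ω) (hΩB : closure Ω ⊆ ball c R) {η ηhat : ℂ → ℂ}
    (hη : ContinuousOn η (frontier Ω)) {f ψ : ℤ → ℂ}
    (h : SolvesImpedance c R Bhat ηhat k2 f 0 ψ v) :
    ∃ g : HNegHalf Ω, SolvesImpedance c R Ω η k2 f g ψ v := by
  obtain ⟨p₁, p₂, t, hs, -, hw, hC⟩ := h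
  refine OneWave.exists_solvesImpedance isClosed_closure hΩ hBΩ hΩB hη hs (fun φ hφ hφs => ?_) hC
  have e := hw ⟨φ, hφ⟩ (hφs.trans sdiff_subset)
  refine e.trans ?_
  -- On `∂Bhat` the test function vanishes.
  have e0 : ∫ x, ηhat x * t x * φ x ∂(bdry Bhat) = 0 := by
    refine integral_eq_zero_of_ae ?_
    filter_upwards [ae_restrict_mem isClosed_frontier.measurableSet] with x hx
    have : φ x = 0 := image_eq_zero_of_notMem_tsupport fun hx' =>
      (hφs hx').2 (frontier_subset_closure hx)
    simp [this]
  simp [e0]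

end

end OneWave

end

open OneWave in
theorem mainTheorem9
    -- the disk `B = ball c R`, the test domain `Ω`, the background obstacle `Bhat`, and `D`
    (c : ℂ) (R : ℝ) (hR : 0 < R) (Ω Bhat D : Set ℂ)
    (hΩ : IsLipschitzDomain Ω) (hBhat : IsLipschitzDomain Bhat) (hD : IsOpen D)
    (hΩB : closure Ω ⊆ Metric.ball c R) (hBhatΩ : closure Bhat ⊆ Ω) (hDΩ : closure D ⊆ Ω)
    -- the impedance coefficients on `∂Ω` and on `∂Bhat`
    (η ηhat : ℂ → ℂ) (hη : ContinuousOn η (frontier Ω))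
    (hηhat : ContinuousOn ηhat (frontier Bhat))
    (σ q τ κ : ℂ) (hσ : σ ≠ 0)
    -- well-posedness behind `A(κ², Bhat)`, `A(q/σ, Bhat)` and `G(q/σ, Ω)`
    (hκ : UniquelySolvable c R Bhat ηhat (κ ^ 2))
    (hk : UniquelySolvable c R Bhat ηhat (q / σ))
    (hG : NotEigenvalue c R Ω η (q / σ))
    -- `u` and `u₀`, with the Dirichlet data `f` and the Neumann data `∂_ν u`, `∂_ν u₀` on `∂B`
    (f dνu dνu₀ : ℤ → ℂ) (u u₀ : ℂ → ℂ) (hf : MemHs (-1 / 2) f)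
    (hu : SolvesDirichlet c R D σ q f dνu u)
    (hu₀ : SolvesImpedance c R Bhat ηhat (κ ^ 2) f 0 dνu₀ u₀) :
    (τ = σ → κ ^ 2 = q / σ →
      σ • dνu - τ • dνu₀ ∈ Set.range (opG c R Ω η (q / σ))) ∧
    (σ • dνu - τ • dνu₀ ∈ Set.range (opG c R Ω η (q / σ)) ↔
      σ • dtn c R Bhat ηhat (q / σ) f - τ • dtn c R Bhat ηhat (κ ^ 2) f ∈
        Set.range (opG c R Ω η (q / σ))) := by
  have hBhatB : closure Bhat ⊆ ball c R := hBhatΩ.trans (subset_closure.trans hΩB)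
  obtain ⟨g, hg⟩ := hu.exists_solvesImpedance hΩ hDΩ hΩB hη hσ
  constructor
  · rintro rfl hκq
    rw [hκq] at hu₀
    obtain ⟨g₀, hg₀⟩ := hu₀.exists_solvesImpedance hΩ hBhatΩ hΩB hη
    rw [← smul_sub]
    exact smul_sub_mem_range_opG hR hΩ hΩB hη hG hg hg₀ τ
  · obtain ⟨v, ψ, hv⟩ := (hk f hf).1
    obtain ⟨g', hg'⟩ := hv.exists_solvesImpedance hΩ hBhatΩ hΩB hη
    rw [dtn_eq hR hBhatB hk hf hv, dtn_eq hR hBhatB hκ hf hu₀]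
    refine mem_range_opG_congr hR hΩ hΩB hη hG ?_
    rw [sub_sub_sub_cancel_right, ← smul_sub]
    exact smul_sub_mem_range_opG hR hΩ hΩB hη hG hg hg' σ
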